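/- Call a group $G$ \emph{fully realizable} if there is a ring $R$ with identity and an identification $R^\times \cong G$ under which every group endomorphism of $G$ is induced by a (unital) ring endomorphism of $R$. Let $p$ be a prime and $n \ge 0$ an integer, let $A$ be a finite elementary abelian $2$-group, let $C_{p^n}$ be the cyclic group of order $p^n$, and let $G = A \rtimes_\phi C_{p^n}$ be the semidirect product determined by an arbitrary homomorphism $\phi \colon C_{p^n} \to \mathrm{Aut}(A)$. If $G$ is fully realizable, then $p^n \in \{1, 2, 3, 4\}$. Moreover: \begin{enumerate} \item If $p^n = 2$, then $G$ is fully realizable if and only if $G$ is abelian. \item If $p^n = 4$, then $G$ is fully realizable if and only if $C_4$ does not act faithfully on $A$ (that is, $\phi$ is not injective). \item If $p^n = 1$ or $p^n = 3$, then $G$ is fully realizable. \end{enumerate} -/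

import Mathlib

universe u v w

/-- The unital ring `R` fully realizes the group `G`: under some identification `e` of the unit
group `Rˣ` with `G`, every group endomorphism of `G` is induced by a unital ring endomorphism
of `R`. -/
def FullyRealizes (R : Type v) [Ring R] (G : Type u) [Group G] : Prop :=
  ∃ e : Rˣ ≃* G, ∀ f : G →* G, ∃ φ : R →+* R,
    ∀ x : Rˣ, e (Units.map (φ : R →* R) x) = f (e x)

/-- The group `G` is fully realizable: some ring fully realizes it. The universe of the ring
is a free parameter. -/
def FullyRealizable.{a, b} (G : Type a) [Group G] : Prop :=
  ∃ (R : Type b) (_ : Ring R), FullyRealizes R G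

/-! Write elements of `G` for their images in `R`, let `c` generate the cyclic factor, and put `u =
ι (inr c)`, `y = 1 + u`. A lift of the trivial endomorphism sends -1 both to -1 and to 1, so `R` has
characteristic 2.

Bound on the order: a geometric sum in `u` of length prime to `2 * p ^ n` is a unit, hence an
element of `G`, and the retraction of `G` onto `⟨c⟩` makes it a power of `u`. Lifting inversion then
gives `(1 + u + ... + u ^ r) ^ 2 = u ^ r`. Length 3 yields `u ^ 4 = 1` when `p ≠ 3`; length 5 yields
`u ^ 12 = 1` when `p = 3`.

Obstructions: the elements `1 + a`, for `a` in `A`, commute, square to zero, and are stable under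
addition and under multiplication by `G` on either side (`augSet_mul_mem`, `augSet_add_mem`).
Endomorphisms of `G` with small image then leave few possible values for products with `y`. For
order 2, if `c` moves `a`, then `⟨a, c⟩` is a dihedral retract with an endomorphism exchanging `a`
and `c`; `(1 + a) * y` has only four candidates, and each makes `a` and `c` commute. For order 4, `y
^ 3 = 0`, and the same cubic for `a * c` gives a relation linear in `x = 1 + a`, namely `y²x + yxy +
xy² = 0`. If the action is faithful, `t = 1 + c` on `A` has `t² ≠ 0`, and equivariant maps built
from a functional force `y` to act on each element of `ker t²` as 0 or as `t`, which contradicts the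
relation.

Constructions: an elementary abelian `G` is the unit group of the square-zero extension of `𝔽₂` by
`G`. Otherwise extend a commutative ring `S`, additively spanned by its unit group `C`, by the
bimodule `A` with left action `φ` and trivial right action. Here `S` is `𝔽₂[g]/(g³ - 1)` or
`𝔽₂[g]/(1 + g)³`. -/

open SemidirectProduct

/-! ### Unit embeddings and characteristic two -/

/-- The monoid homomorphism `ι` identifies `G` with the unit group of `R`, and every endomorphism
of `G` extends to a ring endomorphism of `R`. -/
structure FullUnitEmbedding {R G : Type*} [Ring R] [Group G] (ι : G →* R) : Prop where
  injective : Function.Injective ι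
  exists_of_isUnit : ∀ r : R, IsUnit r → ∃ g, ι g = r
  exists_lift : ∀ f : G →* G, ∃ φ : R →+* R, ∀ g, φ (ι g) = ι (f g)

theorem FullyRealizes.exists_fullUnitEmbedding {R G : Type*} [Ring R] [Group G]
    (h : FullyRealizes R G) : ∃ ι : G →* R, FullUnitEmbedding ι := by
  obtain ⟨e, he⟩ := h
  refine ⟨(Units.coeHom R).comp e.symm.toMonoidHom, ?_, ?_, ?_⟩
  · intro a b hab
    exact e.symm.injective (Units.ext hab)
  · rintro _ ⟨u, rfl⟩
    exact ⟨e u, by simp⟩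
  · intro f
    obtain ⟨φ, hφ⟩ := he f
    refine ⟨φ, fun g => ?_⟩
    have := hφ (e.symm g)
    rw [MulEquiv.apply_symm_apply, ← MulEquiv.eq_symm_apply] at this
    have := congrArg Units.val this
    simpa using this

theorem exists_fullUnitEmbedding_of_fullyRealizable.{a, b} {G : Type a} [Group G]
    (h : FullyRealizable.{a, b} G) :
    ∃ (R : Type b) (_ : Ring R) (ι : G →* R), FullUnitEmbedding ι := by
  obtain ⟨R, _, hR⟩ := h
  exact ⟨R, _, hR.exists_fullUnitEmbedding⟩

namespace FullUnitEmbedding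

variable {R G : Type*} [Ring R] [Group G] {ι : G →* R}

theorem two_eq_zero (h : FullUnitEmbedding ι) : (2 : R) = 0 := by
  obtain ⟨φ, hφ⟩ := h.exists_lift 1
  obtain ⟨g, hg⟩ := h.exists_of_isUnit (-1) isUnit_one.neg
  have h1 := hφ g
  rw [hg] at h1
  simp only [map_neg, map_one, MonoidHom.one_apply] at h1
  rw [← one_add_one_eq_two]
  nth_rewrite 1 [← h1]
  simp

theorem eq_one_of_apply (h : FullUnitEmbedding ι) {g : G} (hg : ι g = 1) : g = 1 :=
  h.injective (by rw [hg, map_one])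

end FullUnitEmbedding

/-! ### Geometric sums and the bound on the cyclic order -/

/-- In characteristic 2 the sum of length `2 * q` vanishes. If `r * m ≡ 1` modulo `2 * q`, the sum
of length `r * m` therefore equals 1, and the sum of length `r` divides it. -/
theorem isUnit_geom_sum_of_coprime {R : Type*} [Ring R] (h2 : (2 : R) = 0) {y : R} {q r : ℕ}
    (hy : y ^ q = 1) (hq : 0 < q) (hr : r.Coprime (2 * q)) :
    IsUnit (∑ j ∈ Finset.range r, y ^ j) := by
  set s : ℕ → R := fun k => ∑ j ∈ Finset.range k, y ^ j with hs
  have hsadd : ∀ a b, s (a + b) = s a + y ^ a * s b := by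
    intro a b
    simp only [hs, Finset.sum_range_add, Finset.mul_sum, pow_add]
  have h2q : s (2 * q) = 0 := by
    rw [two_mul, hsadd, hy, one_mul, ← two_mul, h2, zero_mul]
  have hmul : ∀ k, s (2 * q * k) = 0 := by
    intro k
    induction k with
    | zero => simp [hs]
    | succ k ih =>
      rw [mul_add, hsadd, ih, mul_one, h2q]
      simp
  have hpow : ∀ k, y ^ (2 * q * k) = 1 := by
    intro k
    rw [mul_comm 2 q, mul_assoc, pow_mul, hy, one_pow]
  obtain ⟨m, -, hm⟩ := Nat.exists_mul_mod_eq_one_of_coprime hr (by omega)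
  have hfac : ∀ m, s (r * m) = s r * ∑ i ∈ Finset.range m, (y ^ r) ^ i := by
    intro m
    induction m with
    | zero => simp [hs]
    | succ m ih =>
      rw [mul_add, mul_one, hsadd, ih, Finset.sum_range_succ, mul_add, ← pow_mul]
      congr 1
      exact (Commute.sum_right _ _ _ fun i _ => (Commute.refl y).pow_pow _ _)
  have hone : s (r * m) = 1 := by
    rw [← Nat.div_add_mod (r * m) (2 * q), hm, hsadd, hmul, hpow]
    simp [hs]
  have hcomm : Commute (s r) (∑ i ∈ Finset.range m, (y ^ r) ^ i) := by
    refine Commute.sum_left _ _ _ fun i _ => Commute.sum_right _ _ _ fun j _ => ?_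
    rw [← pow_mul]
    exact (Commute.refl y).pow_pow _ _
  rw [hfac] at hone
  exact ⟨⟨s r, _, hone, by rw [← hcomm.eq, hone]⟩, rfl⟩

namespace FullUnitEmbedding

variable {R G : Type*} [Ring R] [Group G] {ι : G →* R}

/-- A geometric sum in `ι c` that is a unit lies in `⟨ι c⟩`, if `⟨c⟩` is a retract of the group. -/
theorem exists_geom_sum_eq (h : FullUnitEmbedding ι) {c : G} {q r : ℕ} (hc : c ^ q = 1)
    (hq : 0 < q) (hr : r.Coprime (2 * q)) {π : G →* G} (hπc : π c = c)
    (hπ : ∀ g, π g ∈ Subgroup.zpowers c) :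
    ∃ g ∈ Subgroup.zpowers c, ι g = ∑ j ∈ Finset.range r, ι c ^ j := by
  obtain ⟨g, hg⟩ := h.exists_of_isUnit _ (isUnit_geom_sum_of_coprime h.two_eq_zero
    (y := ι c) (by rw [← map_pow, hc, map_one]) hq hr)
  obtain ⟨φ, hφ⟩ := h.exists_lift π
  refine ⟨π g, hπ g, ?_⟩
  rw [← hφ, hg, map_sum]
  simp [hφ, hπc]

/-- The sum is some `ι g` with `g` a power of `c`. Inversion sends it to the sum in `c⁻¹`, which is
the original sum reversed and divided by `ι c ^ r`; so `ι g = ι c ^ r * ι g⁻¹`. -/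
theorem sq_geom_sum_eq (h : FullUnitEmbedding ι) {c : G} {q r : ℕ} (hc : c ^ q = 1)
    (hq : 0 < q) (hr : (r + 1).Coprime (2 * q)) {π ν : G →* G} (hπc : π c = c)
    (hπ : ∀ g, π g ∈ Subgroup.zpowers c) (hν : ν c = c⁻¹) :
    (∑ j ∈ Finset.range (r + 1), ι c ^ j) ^ 2 = ι c ^ r := by
  obtain ⟨g, hg, hgs⟩ := h.exists_geom_sum_eq hc hq hr hπc hπ
  obtain ⟨φ, hφ⟩ := h.exists_lift ν
  have hinv : ι c * ι c⁻¹ = 1 := by rw [← map_mul, mul_inv_cancel, map_one]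
  have hνg : ν g = g⁻¹ := by
    obtain ⟨k, rfl⟩ := hg
    simp [hν]
  have h1 : ι g⁻¹ = ∑ j ∈ Finset.range (r + 1), ι c⁻¹ ^ j := by
    rw [← hνg, ← hφ, hgs, map_sum]
    simp [hφ, hν]
  have h2 : ι c ^ r * ι g⁻¹ = ι g := by
    rw [h1, hgs, Finset.mul_sum, ← Finset.sum_range_reflect]
    refine Finset.sum_congr rfl fun j hj => ?_
    have hj' : j ≤ r := by simpa [Nat.lt_succ_iff] using hj
    rw [show r + 1 - 1 - j = r - j by omega]
    nth_rewrite 1 [← Nat.add_sub_of_le hj']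
    rw [pow_add, mul_assoc, ← map_pow, ← map_pow, ← map_pow, ← map_mul, ← map_mul]
    simp
  rw [← hgs, sq]
  nth_rewrite 1 [← h2]
  rw [mul_assoc, ← map_mul]
  simp

theorem pow_four_eq_one (h : FullUnitEmbedding ι) {c : G} {q : ℕ} (hc : c ^ q = 1)
    (hq : 0 < q) (hr : Nat.Coprime 3 (2 * q)) {π ν : G →* G} (hπc : π c = c)
    (hπ : ∀ g, π g ∈ Subgroup.zpowers c) (hν : ν c = c⁻¹) : c ^ 4 = 1 := by
  have h2 := h.two_eq_zero
  have hs := h.sq_geom_sum_eq hc hq (r := 2) hr hπc hπ hν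
  simp only [Finset.sum_range_succ, Finset.sum_range_zero] at hs
  apply h.injective
  rw [map_pow, map_one]
  have h3 : ι c ^ 4 - 1 = (0 + ι c ^ 0 + ι c ^ 1 + ι c ^ 2) ^ 2 - ι c ^ 2
      - 2 * (1 + ι c + ι c ^ 2 + ι c ^ 3) := by noncomm_ring
  rw [hs, h2] at h3
  simpa [sub_eq_zero] using h3

theorem pow_twelve_eq_one (h : FullUnitEmbedding ι) {c : G} {q : ℕ} (hc : c ^ q = 1)
    (hq : 0 < q) (hr : Nat.Coprime 5 (2 * q)) {π ν : G →* G} (hπc : π c = c)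
    (hπ : ∀ g, π g ∈ Subgroup.zpowers c) (hν : ν c = c⁻¹) : c ^ 12 = 1 := by
  have h2 := h.two_eq_zero
  have hs := h.sq_geom_sum_eq hc hq (r := 4) hr hπc hπ hν
  simp only [Finset.sum_range_succ, Finset.sum_range_zero] at hs
  apply h.injective
  rw [map_pow, map_one]
  set y := ι c
  have h3 : (1 + y ^ 2) * (1 + y ^ 6) = 0 := by
    have : (1 + y ^ 2) * (1 + y ^ 6) = (0 + y ^ 0 + y ^ 1 + y ^ 2 + y ^ 3 + y ^ 4) ^ 2 - y ^ 4
        - 2 * (y + y ^ 2 + 2 * y ^ 3 + 2 * y ^ 4 + 2 * y ^ 5 + y ^ 6 + y ^ 7) := by noncomm_ring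
    rw [this, hs, h2]
    simp
  -- The factor `1 - y ^ 2 + y ^ 4` completes `1 + y ^ 2` to `1 + y ^ 6`, whose square is `1 + y ^
  -- 12` modulo 2.
  have h4 : y ^ 12 - 1 = (1 - y ^ 2 + y ^ 4) * ((1 + y ^ 2) * (1 + y ^ 6))
      - 2 * (1 + y ^ 6) := by noncomm_ring
  rw [h3, h2] at h4
  simpa [sub_eq_zero] using h4

end FullUnitEmbedding

theorem prime_pow_mem_of_fullyRealizable.{a, b, d} {p n : ℕ} (hp : p.Prime)
    {A : Type a} [CommGroup A] {C : Type b} [Group C] [IsCyclic C] (hC : Nat.card C = p ^ n)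
    {φ : C →* MulAut A} (h : FullyRealizable.{max a b, d} (A ⋊[φ] C)) :
    p ^ n = 1 ∨ p ^ n = 2 ∨ p ^ n = 3 ∨ p ^ n = 4 := by
  obtain ⟨R, _, ι, h⟩ := exists_fullUnitEmbedding_of_fullyRealizable h
  obtain ⟨c, hc⟩ := IsCyclic.exists_generator (α := C)
  have hord : orderOf c = p ^ n := by rw [orderOf_eq_card_of_forall_mem_zpowers hc, hC]
  have hcq : (SemidirectProduct.inr c : A ⋊[φ] C) ^ (p ^ n) = 1 := by
    rw [← map_pow, ← hord, pow_orderOf_eq_one, map_one]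
  have hpos : 0 < p ^ n := pow_pos hp.pos n
  have hcomm : ∀ x y : C, x * y = y * x := fun x y => by
    obtain ⟨i, rfl⟩ := hc x
    obtain ⟨j, rfl⟩ := hc y
    exact (Commute.refl c).zpow_zpow i j
  let π : A ⋊[φ] C →* A ⋊[φ] C := SemidirectProduct.inr.comp SemidirectProduct.rightHom
  let inv : C →* C := MonoidHom.mk' (fun x => x⁻¹) fun x y => by rw [mul_inv_rev, hcomm]
  let ν : A ⋊[φ] C →* A ⋊[φ] C := SemidirectProduct.inr.comp (inv.comp SemidirectProduct.rightHom)
  have hπ : ∀ g, π g ∈ Subgroup.zpowers (SemidirectProduct.inr c : A ⋊[φ] C) := fun g => by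
    obtain ⟨i, hi⟩ := hc g.right
    exact ⟨i, by simp only [← map_zpow]; simp [π, ← hi]⟩
  have hπc : π (SemidirectProduct.inr c) = SemidirectProduct.inr c := by simp [π]
  have hνc : ν (SemidirectProduct.inr c) = (SemidirectProduct.inr c)⁻¹ := by simp [ν, inv]
  have hdvd : ∀ k, (SemidirectProduct.inr c : A ⋊[φ] C) ^ k = 1 → p ^ n ∣ k := fun k hk => by
    rw [← hord]
    apply orderOf_dvd_of_pow_eq_one
    apply SemidirectProduct.inr_injective (φ := φ)
    rw [map_pow, hk, map_one]
  by_cases h3 : p = 3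
  · have h5 : Nat.Coprime 5 (2 * p ^ n) := by
      subst h3
      exact Nat.Coprime.mul_right (by norm_num) (Nat.Coprime.pow_right n (by norm_num))
    have hd := hdvd 12 (h.pow_twelve_eq_one hcq hpos h5 hπc hπ hνc)
    have : p ^ n ∣ 3 := by
      subst h3
      exact Nat.Coprime.dvd_of_dvd_mul_left
        (Nat.Coprime.pow_left n (by norm_num : Nat.Coprime 3 4)) (show 3 ^ n ∣ 4 * 3 from hd)
    rcases (Nat.dvd_prime Nat.prime_three).1 this with h | h <;> simp [h]
  · have h3' : Nat.Coprime 3 (2 * p ^ n) :=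
      Nat.Coprime.mul_right (by norm_num)
        (Nat.Coprime.pow_right n ((Nat.coprime_primes Nat.prime_three hp).2 (Ne.symm h3)))
    have hd := hdvd 4 (h.pow_four_eq_one hcq hpos h3' hπc hπ hνc)
    have hle := Nat.le_of_dvd (by norm_num) hd
    omega

/-! ### The ideal attached to the normal factor -/

/-- A power of `x * g` is a product of conjugates of `x`, starting with `x`, times a power of `g`.
At exponent `m` the power of `g` disappears, so one more factor brings in a second `x`, which moves
next to the first. -/
theorem isNilpotent_mul_of_commute_conj {R : Type*} [Ring R] {x : R} (hx : x * x = 0) {g : Rˣ}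
    {m : ℕ} (hm : 0 < m) (hg : g ^ m = 1)
    (hcomm : ∀ k : ℕ, Commute x ((g ^ k : Rˣ) * x * ((g ^ k)⁻¹ : Rˣ))) :
    IsNilpotent (x * g) := by
  have key : ∀ k : ℕ, ∃ s, Commute x s ∧ (x * (g : R)) ^ (k + 1) = x * s * (g ^ (k + 1) : Rˣ) := by
    intro k
    induction k with
    | zero => exact ⟨1, Commute.one_right x, by simp⟩
    | succ k ih =>
      obtain ⟨s, hs, hk⟩ := ih
      refine ⟨s * ((g ^ (k + 1) : Rˣ) * x * ((g ^ (k + 1))⁻¹ : Rˣ)), hs.mul_right (hcomm _), ?_⟩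
      rw [pow_succ, hk, pow_succ g (k + 1), Units.val_mul]
      simp only [mul_assoc, Units.inv_mul_cancel_left]
  obtain ⟨s, hs, hk⟩ := key (m - 1)
  rw [Nat.sub_add_cancel hm] at hk
  refine ⟨m + 1, ?_⟩
  rw [pow_succ, hk, hg, Units.val_one, mul_one, ← mul_assoc, mul_assoc x s x, ← hs.eq,
    ← mul_assoc, hx, zero_mul, zero_mul]

/-- The elements `r` such that `1 + r` is the image of an element of the normal factor. -/
def augSet {R A C : Type*} [Ring R] [Group A] [Group C] {φ : C →* MulAut A}
    (ι : A ⋊[φ] C →* R) : Set R :=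
  {r | ∃ a : A, ι (SemidirectProduct.inl a) = 1 + r}

namespace FullUnitEmbedding

variable {R A C : Type*} [Ring R] [CommGroup A] [Group C] {φ : C →* MulAut A}
  {ι : A ⋊[φ] C →* R}

theorem add_self (h : FullUnitEmbedding ι) (r : R) : r + r = 0 := by
  rw [← two_mul, h.two_eq_zero, zero_mul]

theorem one_add_mem_augSet (h : FullUnitEmbedding ι) (a : A) : 1 + ι (inl a) ∈ augSet ι :=
  ⟨a, by rw [← add_assoc, h.add_self, zero_add]⟩

theorem commute_of_mem_augSet {x x' : R} (hx : x ∈ augSet ι) (hx' : x' ∈ augSet ι) :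
    x * x' = x' * x := by
  obtain ⟨a, ha⟩ := hx
  obtain ⟨b, hb⟩ := hx'
  have : ι (inl a) * ι (inl b) = ι (inl b) * ι (inl a) := by
    rw [← map_mul, ← map_mul, ← map_mul, ← map_mul, mul_comm]
  rw [ha, hb] at this
  have h1 : x * x' - x' * x = (1 + x) * (1 + x') - (1 + x') * (1 + x) := by noncomm_ring
  rw [this, sub_self] at h1
  exact sub_eq_zero.1 h1

theorem mul_self_of_mem_augSet (h : FullUnitEmbedding ι) (hA : ∀ a : A, a ^ 2 = 1) {x : R}
    (hx : x ∈ augSet ι) : x * x = 0 := by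
  obtain ⟨a, ha⟩ := hx
  have : ι (inl a) * ι (inl a) = 1 := by
    rw [← map_mul, ← map_mul, ← sq, hA, map_one, map_one]
  rw [ha] at this
  have h1 : x * x = (1 + x) * (1 + x) - 1 - 2 * x := by noncomm_ring
  rw [h1, this, h.two_eq_zero]
  simp

theorem conj_mem_augSet {x : R} (hx : x ∈ augSet ι) (g : A ⋊[φ] C) :
    ι g * x * ι g⁻¹ ∈ augSet ι := by
  obtain ⟨a, ha⟩ := hx
  have hn : g * inl a * g⁻¹ = inl (g.left * φ g.right a * g.left⁻¹) := by
    ext <;> simp [mul_assoc]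
  refine ⟨g.left * φ g.right a * g.left⁻¹, ?_⟩
  rw [← hn, map_mul, map_mul, ha, mul_add, add_mul, mul_one, ← map_mul, mul_inv_cancel, map_one]

/-- By nilpotence `1 + x * ι g` is a unit, hence comes from `G`. The lift of the projection onto `C`
kills `x`, so this group element projects to 1 and lies in `A`. -/
theorem augSet_mul_mem (h : FullUnitEmbedding ι) [Finite A] [Finite C]
    (hA : ∀ a : A, a ^ 2 = 1) {x : R} (hx : x ∈ augSet ι) (g : A ⋊[φ] C) :
    x * ι g ∈ augSet ι := by
  have : Finite (A ⋊[φ] C) := Finite.of_equiv _ SemidirectProduct.equivProd.symm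
  have hu : IsUnit (1 + x * ι g) := by
    have := isNilpotent_mul_of_commute_conj (h.mul_self_of_mem_augSet hA hx)
      (g := Units.map ι (toUnits g)) (m := orderOf g) (orderOf_pos g)
      (by rw [← map_pow, ← map_pow, pow_orderOf_eq_one, map_one, map_one]) (fun k => by
        have := commute_of_mem_augSet hx (conj_mem_augSet hx (g ^ k))
        rw [← map_pow, ← map_pow, ← map_inv, ← map_inv]
        exact this)
    exact this.isUnit_one_add
  obtain ⟨g', hg'⟩ := h.exists_of_isUnit _ hu
  obtain ⟨ψ, hψ⟩ := h.exists_lift (inr.comp rightHom)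
  have hψx : ψ x = 0 := by
    obtain ⟨a, ha⟩ := hx
    have := hψ (inl a)
    rw [ha] at this
    simpa using this
  have h1 := hψ g'
  rw [hg', map_add, map_mul, hψx, zero_mul, map_one, add_zero] at h1
  have h2 : g'.right = 1 := by
    exact inr_injective (φ := φ) ((h.eq_one_of_apply h1.symm).trans (map_one _).symm)
  refine ⟨g'.left, ?_⟩
  rw [← hg']
  congr 1
  ext <;> simp [h2]

theorem mul_augSet_mem (h : FullUnitEmbedding ι) [Finite A] [Finite C]
    (hA : ∀ a : A, a ^ 2 = 1) {x : R} (hx : x ∈ augSet ι) (g : A ⋊[φ] C) :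
    ι g * x ∈ augSet ι := by
  have := h.augSet_mul_mem hA (conj_mem_augSet hx g) g
  rwa [mul_assoc, ← map_mul, inv_mul_cancel, map_one, mul_one] at this

theorem augSet_add_mem (h : FullUnitEmbedding ι) [Finite A] [Finite C]
    (hA : ∀ a : A, a ^ 2 = 1) {x x' : R} (hx : x ∈ augSet ι) (hx' : x' ∈ augSet ι) :
    x + x' ∈ augSet ι := by
  obtain ⟨a, ha⟩ := hx
  obtain ⟨b, hb⟩ := h.mul_augSet_mem hA hx' (inl a⁻¹)
  refine ⟨a * b, ?_⟩
  rw [map_mul, map_mul, hb, mul_add, mul_one, ← mul_assoc, ← map_mul, ← map_mul, mul_inv_cancel,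
    map_one, map_one, one_mul, ha, add_assoc]

theorem augSet_mul_apply_mul (h : FullUnitEmbedding ι) [Finite A] [Finite C]
    (hA : ∀ a : A, a ^ 2 = 1) {x : R} (hx : x ∈ augSet ι) (g : A ⋊[φ] C) :
    x * ι g * x = 0 := by
  rw [commute_of_mem_augSet (h.augSet_mul_mem hA hx g) hx, ← mul_assoc,
    h.mul_self_of_mem_augSet hA hx, zero_mul]

end FullUnitEmbedding

/-! ### Building homomorphisms from functionals and generators -/

/-- The homomorphism from the group of order two sending the generator to an involution. -/
def involutionHom {G : Type*} [Group G] (t : G) (ht : t ^ 2 = 1) :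
    Multiplicative (ZMod 2) →* G where
  toFun z := t ^ (z.toAdd.val)
  map_one' := by simp
  map_mul' := by
    intro z w
    change t ^ (z.toAdd + w.toAdd).val = t ^ z.toAdd.val * t ^ w.toAdd.val
    rw [← pow_add, ZMod.val_add, ← pow_eq_pow_mod _ ht]

theorem involutionHom_ofAdd_one {G : Type*} [Group G] (t : G) (ht : t ^ 2 = 1) :
    involutionHom t ht (Multiplicative.ofAdd 1) = t := by
  change t ^ (1 : ZMod 2).val = t
  simp [ZMod.val_one]

theorem exists_hom_zmod_two {A : Type*} [CommGroup A] (hA : ∀ a : A, a ^ 2 = 1) (H : Subgroup A)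
    {a : A} (ha : a ∉ H) :
    ∃ χ : A →* Multiplicative (ZMod 2), χ a = Multiplicative.ofAdd 1 ∧ ∀ b ∈ H, χ b = 1 := by
  let _ : Module (ZMod 2) (Additive A) := AddCommGroup.zmodModule fun x => hA x.toMul
  obtain ⟨f, hf, hH⟩ := Submodule.exists_le_ker_of_notMem
    (p := AddSubgroup.toZModSubmodule 2 (Subgroup.toAddSubgroup H)) (v := Additive.ofMul a) ha
  refine ⟨AddMonoidHom.toMultiplicativeRight f.toAddMonoidHom, ?_, fun b hb => hH hb⟩
  have : ∀ z : ZMod 2, z ≠ 0 → z = 1 := by decide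
  exact congrArg Multiplicative.ofAdd (this _ hf)

theorem eq_one_or_of_multiplicative_zmod_two (z : Multiplicative (ZMod 2)) :
    z = 1 ∨ z = Multiplicative.ofAdd 1 := by
  revert z
  decide

namespace SemidirectProduct

/-- An endomorphism of `A ⋊ C`, with `C` cyclic, from its values on `A` and on a generator. -/
theorem exists_endomorphism {A C H : Type*} [Group A] [Group C] [Group H] {φ : C →* MulAut A}
    {c : C}
    (hc : ∀ x, x ∈ Subgroup.zpowers c) (f : A →* H) (t : H) (ht : t ^ orderOf c = 1)
    (hf : ∀ b, f (φ c b) = t * f b * t⁻¹) :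
    ∃ F : A ⋊[φ] C →* H, (∀ b, F (inl b) = f b) ∧ F (inr c) = t := by
  let f₂ : C →* H := monoidHomOfForallMemZpowers hc (orderOf_dvd_of_pow_eq_one ht)
  have hf₂ : f₂ c = t := monoidHomOfForallMemZpowers_apply_gen hc _
  have hfz : ∀ k : ℕ, ∀ b, f (φ (c ^ k) b) = t ^ k * f b * (t ^ k)⁻¹ := by
    intro k
    induction k with
    | zero => simp
    | succ k ih =>
      intro b
      rw [pow_succ', map_mul, MulAut.mul_apply, hf, ih, pow_succ']
      group
  have hfz' : ∀ k : ℕ, ∀ b, f (φ (c ^ k)⁻¹ b) = (t ^ k)⁻¹ * f b * (t ^ k) := by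
    intro k b
    have := hfz k (φ (c ^ k)⁻¹ b)
    rw [← MulAut.mul_apply, ← map_mul, mul_inv_cancel, map_one, MulAut.one_apply] at this
    rw [this]
    group
  refine ⟨lift f f₂ fun g => ?_, fun b => by simp, by simp [hf₂]⟩
  ext b
  obtain ⟨k, rfl⟩ := hc g
  simp only [MonoidHom.comp_apply, MulEquiv.coe_toMonoidHom, MulAut.conj_apply, map_zpow f₂, hf₂]
  rcases Int.eq_nat_or_neg k with ⟨k, rfl | rfl⟩
  · simpa using hfz k b
  · simpa using hfz' k b

end SemidirectProduct

/-! ### Order two: the action is trivial -/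

/-- The first and last alternatives make one of `x * y`, `y * x` vanish, and `S` transports this to
the other. The middle two make `x` a multiple of itself by `±y`, so `x = 0`. -/
theorem mul_comm_of_exchange {R : Type*} [Ring R] {x y : R}
    (hyy : y * y = 0) (S : R →+* R) (hSx : S x = y) (hSy : S y = x)
    (hxy : x * y = 0 ∨ x * y = x ∨ x * y = x + x * y + y * x ∨ x * y = x * y + y * x) :
    x * y = y * x := by
  rcases hxy with hxy | hxy | hxy | hxy
  · have := congrArg S hxy
    rw [map_mul, hSx, hSy, map_zero] at this
    rw [hxy, this]
  · have : x = 0 := by rw [← hxy, ← hxy, mul_assoc, hyy, mul_zero]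
    simp [this]
  · have h1 : x = -(y * x) := by
      have : x + y * x = x + x * y + y * x - x * y := by abel
      rw [← hxy, sub_self] at this
      exact eq_neg_of_add_eq_zero_left this
    have h2 : x = 0 := by
      rw [h1, h1, mul_neg, neg_neg, ← mul_assoc, hyy, zero_mul]
    simp [h2]
  · have h1 : y * x = 0 := by simpa using hxy
    have := congrArg S h1
    rw [map_mul, hSx, hSy, map_zero] at this
    rw [h1, this]

theorem commute_of_fullyRealizable_of_card_eq_two.{a, b, d}
    {A : Type a} [CommGroup A] [Finite A] (hA : ∀ a : A, a ^ 2 = 1)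
    {C : Type b} [Group C] [IsCyclic C] (hC : Nat.card C = 2)
    {φ : C →* MulAut A} (h : FullyRealizable.{max a b, d} (A ⋊[φ] C)) :
    ∀ g h : A ⋊[φ] C, g * h = h * g := by
  obtain ⟨R, _, ι, h⟩ := exists_fullUnitEmbedding_of_fullyRealizable h
  have : Finite C := Nat.finite_of_card_ne_zero (by omega)
  obtain ⟨c, hc⟩ := IsCyclic.exists_generator (α := C)
  have hord : orderOf c = 2 := by rw [orderOf_eq_card_of_forall_mem_zpowers hc, hC]
  have hc2 : c ^ 2 = 1 := by rw [← hord, pow_orderOf_eq_one]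
  by_cases hfix : ∀ a, φ c a = a
  · have htriv : ∀ x a, φ x a = a := by
      intro x a
      have hφ : φ c = 1 := MulEquiv.ext hfix
      obtain ⟨k, rfl⟩ := hc x
      simp [hφ]
    have hcomm : ∀ x y : C, x * y = y * x := fun x y => by
      obtain ⟨i, rfl⟩ := hc x
      obtain ⟨j, rfl⟩ := hc y
      exact (Commute.refl c).zpow_zpow i j
    intro g k
    ext
    · simp [htriv, mul_comm]
    · simp [hcomm g.right k.right]
  exfalso
  push Not at hfix
  obtain ⟨a, ha⟩ := hfix
  set a' := φ c a with ha'
  have hca' : φ c a' = a := by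
    rw [ha', ← MulAut.mul_apply, ← map_mul, ← sq, hc2, map_one, MulAut.one_apply]
  have haa : ∀ b : A, b * b = 1 := fun b => by rw [← sq, hA]
  have hainv : ∀ b : A, b⁻¹ = b := fun b => inv_eq_of_mul_eq_one_left (haa b)
  have ha1 : a ≠ 1 := fun h1 => ha (by rw [ha', h1, map_one])
  obtain ⟨χ, hχa, hχ⟩ := exists_hom_zmod_two hA (Subgroup.zpowers a') (a := a) (by
    rintro ⟨k, hk⟩
    change a' ^ k = a at hk
    rcases Int.even_or_odd' k with ⟨m, rfl | rfl⟩
    · rw [zpow_mul, zpow_ofNat, hA, one_zpow] at hk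
      exact ha1 hk.symm
    · rw [zpow_add, zpow_mul, zpow_ofNat, hA, one_zpow, zpow_one, one_mul] at hk
      exact ha hk)
  have hχa' : χ a' = 1 := hχ a' (Subgroup.mem_zpowers a')
  set τ : A →* A := (φ c).toMonoidHom with hτ
  have hττ : ∀ b, τ (φ c b) = b := fun b => by
    change φ c (φ c b) = b
    rw [← MulAut.mul_apply, ← map_mul, ← sq, hc2, map_one, MulAut.one_apply]
  have hχτ : χ (τ a) = 1 := hχa'
  -- the retraction onto the dihedral group generated by `a` and `c`
  obtain ⟨ρ, hρA, hρc⟩ := exists_endomorphism (φ := φ) hc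
    (inl.comp ((involutionHom a (hA a)).comp χ * (involutionHom a' (hA a')).comp (χ.comp τ)))
    (inr c : A ⋊[φ] C) (by rw [← map_pow, pow_orderOf_eq_one, map_one]) (by
      intro b
      have hpow : ∀ z, φ c (involutionHom a (hA a) z) = involutionHom a' (hA a') z := fun z =>
        map_pow _ _ _
      have hpow' : ∀ z, φ c (involutionHom a' (hA a') z) = involutionHom a (hA a) z := fun z => by
        rw [← hpow]; exact hττ _
      rw [← map_inv, MonoidHom.comp_apply, MonoidHom.comp_apply, ← inl_aut]
      congr 1
      simp only [MonoidHom.mul_apply, MonoidHom.comp_apply, hττ, map_mul, hpow, hpow']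
      rw [mul_comm]
      rfl)
  -- the endomorphism exchanging `a` and `c`
  have hc2' : (inr c : A ⋊[φ] C) ^ 2 = 1 := by rw [← map_pow, hc2, map_one]
  have ha2' : (inl a : A ⋊[φ] C) ^ 2 = 1 := by rw [← map_pow, hA, map_one]
  have hainv' : (inl a : A ⋊[φ] C)⁻¹ = inl a := by rw [← map_inv, hainv]
  set k : A ⋊[φ] C := inl a * inr c * (inl a)⁻¹ with hk
  have hk2 : k ^ 2 = 1 := by rw [hk, conj_pow, hc2']; simp
  have hkc : Commute (inr c) k := by
    have : k = inl (a * a') * inr c := by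
      rw [hk, hainv']
      ext <;> simp [ha']
    rw [this]
    refine Commute.mul_right ?_ (Commute.refl _)
    change _ = _
    ext <;> simp [hca', ← ha', mul_comm]
  obtain ⟨σ, hσA, hσc⟩ := exists_endomorphism (φ := φ) hc
    (MonoidHom.mk' (fun b => involutionHom (inr c) hc2' (χ b) * involutionHom k hk2 (χ (τ b)))
      (by
        intro x y
        simp only [map_mul]
        have : Commute (involutionHom (inr c) hc2' (χ y)) (involutionHom k hk2 (χ (τ x))) :=
          hkc.pow_pow _ _
        exact this.mul_mul_mul_comm _ _))
    (inl a) (by rw [hord, ha2']) (by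
      intro b
      have hpow : ∀ z, inl a * involutionHom (inr c) hc2' z * (inl a)⁻¹ =
          involutionHom k hk2 z := fun z => (conj_pow).symm
      have hpow' : ∀ z, inl a * involutionHom k hk2 z * (inl a)⁻¹ =
          involutionHom (inr c) hc2' z := fun z => by
        rw [← hpow]
        have : (inl a : A ⋊[φ] C) * inl a = 1 := by rw [← sq, ha2']
        simp only [hainv', mul_assoc, this]
        simp only [← mul_assoc, this]
        simp
      have hcm : Commute (involutionHom (inr c) hc2' (χ b)) (involutionHom k hk2 (χ (τ b))) :=
          (hkc.pow_pow _ _)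
      simp only [MonoidHom.mk'_apply, hττ]
      rw [hcm.eq, ← conj_mul, hpow, hpow']
      rfl)
  obtain ⟨P, hP⟩ := h.exists_lift ρ
  obtain ⟨S, hS⟩ := h.exists_lift σ
  have hσa : σ (inl a) = inr c := by
    rw [hσA]
    simp [hχa, hχτ, involutionHom_ofAdd_one]
  have hρa : ρ (inl a) = inl a := by
    rw [hρA]
    simp [hχa, hχτ, involutionHom_ofAdd_one]
  set X := ι (inl a)
  set Y := ι (inr c)
  set X' := ι (inl a')
  have hSX : S X = Y := by rw [hS, hσa]
  have hSY : S Y = X := by rw [hS, hσc]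
  have h2 := h.two_eq_zero
  have hself := h.add_self
  have hYX : Y * X = X' * Y := by
    simp only [X, Y, X', ← map_mul]
    congr 1
    ext <;> simp [ha']
  have hYY : Y * Y = 1 := by simp only [Y, ← map_mul]; rw [← sq, hc2]; simp
  have hxJ : 1 + X ∈ augSet ι := h.one_add_mem_augSet a
  have hxx : (1 + X) * (1 + X) = 0 := h.mul_self_of_mem_augSet hA hxJ
  have hyy : (1 + Y) * (1 + Y) = 0 := by
    have : (1 + Y) * (1 + Y) = Y * Y - 1 + 2 * (1 + Y) := by noncomm_ring
    rw [this, hYY, h2]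
    simp
  have hxyJ : (1 + X) * (1 + Y) ∈ augSet ι := by
    rw [mul_add, mul_one]
    exact h.augSet_add_mem hA hxJ (h.augSet_mul_mem hA hxJ _)
  have hxyx : (1 + X) * (1 + Y) * (1 + X) = 0 := by
    rw [FullUnitEmbedding.commute_of_mem_augSet hxyJ hxJ, ← mul_assoc, hxx, zero_mul]
  have hyxy : (1 + Y) * (1 + X) * (1 + Y) = 0 := by
    have := congrArg S hxyx
    simpa only [map_mul, map_add, map_one, hSX, hSY, map_zero] using this
  set x := 1 + X with hx
  set y := 1 + Y with hy
  have hX : X = 1 + x := by rw [hx, ← add_assoc, hself, zero_add]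
  have hY : Y = 1 + y := by rw [hy, ← add_assoc, hself, zero_add]
  have hX' : X' = 1 + (x + x * y + y * x) := by
    have h1 : X' = Y * X * Y := by rw [hYX, mul_assoc, hYY, mul_one]
    have h3 : (1 + y) * (1 + x) * (1 + y) =
        1 + (x + x * y + y * x) + 2 * y + y * y + y * x * y := by noncomm_ring
    rw [h1, hX, hY, h3, hyy, hyxy, h2]
    simp
  have hXX' : X * X' = 1 + (x * y + y * x) := by
    have h3 : (1 + x) * (1 + (x + x * y + y * x)) =
        1 + (x * y + y * x) + 2 * x + x * x + x * x * y + x * y * x := by noncomm_ring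
    rw [hX', hX, h3, hxx, hxyx, h2]
    simp
  -- The lift `P` of the retraction fixes `x` and `y`, so `1 + x * y` lies in the image of `A` under
  -- `ρ`, which is `{1, a, a', a * a'}`.
  have hcases : x * y = 0 ∨ x * y = x ∨ x * y = x + x * y + y * x ∨ x * y = x * y + y * x := by
    obtain ⟨b, hb⟩ := hxyJ
    have h1 := hP (inl b)
    have hPx : P x = x := by rw [hx, map_add, map_one, hP, hρa]
    have hPy : P y = y := by rw [hy, map_add, map_one, hP, hρc]
    rw [hb, map_add, map_mul, hPx, hPy, map_one, hρA] at h1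
    simp only [MonoidHom.comp_apply, MonoidHom.mul_apply] at h1
    rcases eq_one_or_of_multiplicative_zmod_two (χ b) with h4 | h4 <;>
    rcases eq_one_or_of_multiplicative_zmod_two (χ (τ b)) with h5 | h5 <;>
    simp only [h4, h5, involutionHom_ofAdd_one, map_one, one_mul, mul_one, map_mul] at h1
    · left; simpa using h1
    · right; right; left
      exact add_left_cancel (h1.trans hX')
    · right; left
      exact add_left_cancel (h1.trans hX)
    · right; right; right
      exact add_left_cancel (h1.trans hXX')
  have hSx : S x = y := by rw [hx, map_add, map_one, hSX]
  have hSy : S y = x := by rw [hy, map_add, map_one, hSY]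
  have hxy := mul_comm_of_exchange hyy S hSx hSy hcases
  have hX'X : X' = X := by
    rw [hX', hX, hxy, add_assoc x, hself, add_zero]
  exact ha (inl_injective (φ := φ) (h.injective hX'X))

/-! ### Order four: the action is not faithful -/

/-- The contradiction in the ring: `l`, `r` denote left and right multiplication by `y`. -/
theorem eq_zero_of_quadratic_relation {R : Type*} [Ring R] (h2 : (2 : R) = 0) {u d x : R}
    (hdu : d * u = 1) (e z : R) (he : e = x + u * x * d) (hz : z = e + u * e * d)
    (hzu : u * z = z * u)
    (hrel : (1 + u) * (1 + u) * x + (1 + u) * x * (1 + u) + x * (1 + u) * (1 + u) = 0)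
    (hK : ∀ w ∈ ({z, (1 + u) * x, x * (1 + u)} : Set R), u * w = w * u →
      (1 + u) * w = 0 ∧ w * (1 + u) = 0)
    (hl : (1 + u) * e = 0 ∨ (1 + u) * e = z) (hr : e * (1 + u) = 0 ∨ e * (1 + u) = z) :
    z = 0 := by
  have hself : ∀ r : R, r + r = 0 := fun r => by rw [← two_mul, h2, zero_mul]
  have heu : e * u = u * x + x * u := by
    rw [he, add_mul, mul_assoc _ d u, hdu, mul_one, add_comm]
  have hzu' : z * u = u * e + e * u := by
    rw [hz, add_mul, mul_assoc _ d u, hdu, mul_one, add_comm]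
  obtain ⟨hyz, hzy⟩ := hK z (by simp) hzu
  have hsum : (1 + u) * e + e * (1 + u) = z := by
    have : (1 + u) * e + e * (1 + u) = 2 * e + (u * e + e * u) := by noncomm_ring
    rw [this, ← hzu', h2, zero_mul, zero_add]
    have : z * u = z * (1 + u) - z := by noncomm_ring
    rw [this, hzy, zero_sub]
    exact neg_eq_of_add_eq_zero_left (hself z)
  have hyx : (1 + u) * x + x * (1 + u) = e + e * (1 + u) := by
    have h1 : (1 + u) * x + x * (1 + u) = 2 * x + (u * x + x * u) := by noncomm_ring
    have h3 : e + e * (1 + u) = 2 * e + e * u := by noncomm_ring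
    rw [h1, h3, heu, h2, zero_mul, zero_mul]
  have hux : u * x + x * u = (1 + u) * x + x * (1 + u) := by
    have h1 : (1 + u) * x + x * (1 + u) = 2 * x + (u * x + x * u) := by noncomm_ring
    rw [h1, h2, zero_mul, zero_add]
  -- With `y = 1 + u`, `hsum` reads `ye + ey = z`, so equal values of `ye` and `ey` give `z = 0`. In
  -- the mixed cases `yx` or `xy` commutes with `u`; `hK` kills two terms of `hrel`, hence the
  -- third, and multiplying `hyx` by `y` leaves `z = 0`.
  rcases hl with hl | hl <;> rcases hr with hr | hr
  · rw [← hsum, hl, hr, add_zero]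
  · -- `(1 + u) * x` commutes with `u`
    have hw : u * ((1 + u) * x) = (1 + u) * x * u := by
      have h0 : (1 + u) * (e * u) = 0 := by rw [← mul_assoc, hl, zero_mul]
      rw [heu] at h0
      have h1 : u * ((1 + u) * x) - (1 + u) * x * u =
          (1 + u) * (u * x + x * u) - 2 * ((1 + u) * x * u) := by noncomm_ring
      rw [h0, h2, zero_mul, sub_zero] at h1
      exact sub_eq_zero.1 h1
    obtain ⟨hw1, hw2⟩ := hK _ (by simp) hw
    rw [← mul_assoc] at hw1
    rw [hw1, hw2, zero_add, zero_add] at hrel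
    have := congrArg (· * (1 + u)) hyx
    simp only [add_mul _ _ (1 + u), hw2, hrel, hr, hzy, add_zero] at this
    exact this.symm
  · have hw : u * (x * (1 + u)) = x * (1 + u) * u := by
      have h0 : e * u * (1 + u) = 0 := by
        have : e * u * (1 + u) = e * (1 + u) * u := by noncomm_ring
        rw [this, hr, zero_mul]
      rw [heu] at h0
      have h1 : u * (x * (1 + u)) - x * (1 + u) * u =
          (u * x + x * u) * (1 + u) - 2 * (x * (1 + u) * u) := by noncomm_ring
      rw [h0, h2, zero_mul, sub_zero] at h1
      exact sub_eq_zero.1 h1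
    obtain ⟨hw1, hw2⟩ := hK _ (by simp) hw
    rw [mul_assoc _ x, hw1, hw2, add_zero, add_zero] at hrel
    have := congrArg ((1 + u) * ·) hyx
    simp only [mul_add (1 + u) _ (x * (1 + u)), mul_add (1 + u) e, hw1, ← mul_assoc _ _ x, hrel,
      ← mul_assoc _ e, hl, hzy, add_zero] at this
    exact this.symm
  · rw [← hsum, hl, hr, hself]

theorem mul_eq_zero_of_pow_three_eq_zero {R : Type*} [Ring R] {y w : R} (hy : y * y * y = 0)
    (hw : y * w = w) : w = 0 := by
  rw [← hw, ← hw, ← hw, ← mul_assoc, ← mul_assoc, hy, zero_mul]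

namespace FullUnitEmbedding

variable {R A C : Type*} [Ring R] [CommGroup A] [Group C] {φ : C →* MulAut A}
  {ι : A ⋊[φ] C →* R}

/-- This makes `b ↦ φ c b * b` additive in the ring: it becomes the identity plus conjugation by
`c`, because the cross term contains `x * ι (inr c) * x = 0`. -/
theorem one_add_apply_mul_eq (h : FullUnitEmbedding ι) [Finite A] [Finite C]
    (hA : ∀ a : A, a ^ 2 = 1) (c : C) (b : A) :
    1 + ι (inl (φ c b * b)) =
      (1 + ι (inl b)) + ι (inr c) * (1 + ι (inl b)) * ι (inr c⁻¹) := by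
  have h1 := h.augSet_mul_apply_mul hA (h.one_add_mem_augSet b) (inr c)
  have h2 : ι (inr c) * ι (inr c⁻¹) = 1 := by
    rw [← map_mul, ← map_mul, mul_inv_cancel, map_one, map_one]
  have h3 : ι (inl (φ c b * b)) = ι (inl b) * ι (inr c) * ι (inl b) * ι (inr c⁻¹) := by
    rw [← map_mul, ← map_mul, ← map_mul, mul_comm, map_mul, inl_aut]
    simp only [mul_assoc]
  set X := ι (inl b)
  set u := ι (inr c)
  set d := ι (inr c⁻¹)
  have h4 : 1 + X * u * X * d = (1 + X) + u * (1 + X) * d + (1 + X) * u * (1 + X) * d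
      - 2 * (u * d) - 2 * (u * X * d) - X * u * d - X := by noncomm_ring
  have h5 : X * u * d = X := by rw [mul_assoc, h2, mul_one]
  rw [h3, h4, h1, h.two_eq_zero, h5, sub_sub _ X X, h.add_self]
  simp

theorem exists_lift_of_equivariant (h : FullUnitEmbedding ι) {c : C}
    (hc : ∀ x, x ∈ Subgroup.zpowers c) (f : A →* A) (hf : ∀ b, f (φ c b) = φ c (f b)) :
    ∃ S : R →+* R, (∀ b, S (ι (inl b)) = ι (inl (f b))) ∧ S (ι (inr c)) = ι (inr c) := by
  obtain ⟨F, hFA, hFc⟩ := exists_endomorphism (φ := φ) hc (inl.comp f : A →* A ⋊[φ] C) (inr c)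
    (by rw [← map_pow, pow_orderOf_eq_one, map_one]) fun b => by
      rw [← map_inv, MonoidHom.comp_apply, MonoidHom.comp_apply, ← inl_aut, hf]
  obtain ⟨S, hS⟩ := h.exists_lift F
  exact ⟨S, fun b => by rw [hS, hFA]; rfl, by rw [hS, hFc]⟩

theorem exists_eq_one_add_of_mem_augSet (h : FullUnitEmbedding ι) {x : R} (hx : x ∈ augSet ι) :
    ∃ a, x = 1 + ι (inl a) := by
  obtain ⟨a, ha⟩ := hx
  exact ⟨a, by rw [ha, ← add_assoc, h.add_self, zero_add]⟩

/-- An equivariant endomorphism of the normal factor turns multiplication by `1 + c` at `a₀` into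
multiplication by `1 + c` at `f a₀`. -/
theorem exists_one_add_mul_eq (h : FullUnitEmbedding ι) [Finite A] [Finite C]
    (hA : ∀ a : A, a ^ 2 = 1) {c : C}
    (hc : ∀ x, x ∈ Subgroup.zpowers c) (f : A →* A) (hf : ∀ b, f (φ c b) = φ c (f b)) (a : A) :
    (∃ b, (1 + ι (inr c)) * (1 + ι (inl (f a))) = 1 + ι (inl (f b))) ∧
      ∃ b, (1 + ι (inl (f a))) * (1 + ι (inr c)) = 1 + ι (inl (f b)) := by
  obtain ⟨S, hSA, hSc⟩ := h.exists_lift_of_equivariant hc f hf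
  have hJ := h.one_add_mem_augSet a
  constructor
  · have h1 : (1 + ι (inr c)) * (1 + ι (inl a)) ∈ augSet ι := by
      rw [add_mul, one_mul]
      exact h.augSet_add_mem hA hJ (h.mul_augSet_mem hA hJ _)
    obtain ⟨b, hb⟩ := h.exists_eq_one_add_of_mem_augSet h1
    refine ⟨b, ?_⟩
    simpa only [map_mul S, map_add S, map_one S, hSA, hSc] using congrArg S hb
  · have h1 : (1 + ι (inl a)) * (1 + ι (inr c)) ∈ augSet ι := by
      rw [mul_add, mul_one]
      exact h.augSet_add_mem hA hJ (h.augSet_mul_mem hA hJ _)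
    obtain ⟨b, hb⟩ := h.exists_eq_one_add_of_mem_augSet h1
    refine ⟨b, ?_⟩
    simpa only [map_mul S, map_add S, map_one S, hSA, hSc] using congrArg S hb

/-- If `c` has order four, then `1 + c` is nilpotent of index at most three. -/
theorem pow_three_eq_of_orderOf_eq_four (h : FullUnitEmbedding ι) {c : C}
    (hc : ∀ x, x ∈ Subgroup.zpowers c) (hord : orderOf c = 4) :
    ι (inr c) ^ 3 = 1 + ι (inr c) + ι (inr c) ^ 2 := by
  have hc4 : c ^ 4 = 1 := by rw [← hord, pow_orderOf_eq_one]
  obtain ⟨g, ⟨k, hg⟩, hgs⟩ := h.exists_geom_sum_eq (c := inr c) (q := 4) (r := 3)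
    (by rw [← map_pow, hc4, map_one]) (by norm_num) (by norm_num)
    (π := inr.comp rightHom) (by simp) (fun g => by
      obtain ⟨i, hi⟩ := hc g.right
      exact ⟨i, by simp only [← map_zpow]; simp [← hi]⟩)
  have hself := h.add_self
  have hne : ∀ i j : ℕ, i < 4 → j < 4 → i ≠ j → ι (inr c) ^ i ≠ ι (inr c) ^ j := by
    intro i j hi hj hij he
    rw [← map_pow, ← map_pow, ← map_pow, ← map_pow] at he
    exact hij (pow_injOn_Iio_orderOf (x := c) (by simpa [hord] using hi) (by simpa [hord] using hj)
      (inr_injective (h.injective he)))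
  have hgk : ι g = ι (inr c) ^ (k % 4).toNat := by
    rw [← map_pow, ← map_pow, ← hg]
    change ι (inr c ^ k) = _
    rw [← map_zpow]
    congr 2
    rw [← zpow_natCast, Int.toNat_of_nonneg (Int.emod_nonneg _ (by norm_num))]
    have := zpow_mod_orderOf c k
    rw [hord] at this
    exact this.symm
  rw [hgk] at hgs
  have hlt : (k % 4).toNat < 4 := by omega
  generalize (k % 4).toNat = m at hgs hlt
  simp only [Finset.sum_range_succ, Finset.sum_range_zero, zero_add, pow_zero, pow_one] at hgs
  have hneg : ∀ r s : R, r + s = 0 → r = s := fun r s hrs =>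
    (add_eq_zero_iff_eq_neg.1 hrs).trans (neg_eq_of_add_eq_zero_left (hself s))
  -- The unit `1 + u + u ^ 2` is `u ^ m`; exponents 0, 1, 2 would each identify two distinct powers
  -- of `u`.
  interval_cases m
  · exact absurd (hneg (ι (inr c) ^ 1) (ι (inr c) ^ 2) (by
      rw [pow_zero, add_assoc] at hgs
      rw [pow_one]
      simpa using hgs.symm)) (hne 1 2 (by norm_num) (by norm_num) (by norm_num))
  · exact absurd (hneg (ι (inr c) ^ 0) (ι (inr c) ^ 2) (by
      rw [pow_one, add_right_comm] at hgs
      rw [pow_zero]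
      simpa using hgs.symm)) (hne 0 2 (by norm_num) (by norm_num) (by norm_num))
  · exact absurd (hneg (ι (inr c) ^ 0) (ι (inr c) ^ 1) (by
      rw [pow_zero, pow_one]
      simpa using hgs.symm)) (hne 0 1 (by norm_num) (by norm_num) (by norm_num))
  · exact hgs

end FullUnitEmbedding

/-- Subtract the cubic for `u` from that for `(1 + x) * u`. Terms of higher degree in `x` contain `x
* u * x` or `x * u ^ 2 * x`; cancelling `u` from the linear part leaves the relation. -/
theorem quadratic_relation_of_pow_three_eq {R : Type*} [Ring R] (h2 : (2 : R) = 0) {u d x : R}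
    (hud : u * d = 1) (hu : u ^ 3 = 1 + u + u ^ 2)
    (hU : ((1 + x) * u) ^ 3 = 1 + (1 + x) * u + ((1 + x) * u) ^ 2)
    (h1 : x * u * x = 0) (h3 : x * u ^ 2 * x = 0) :
    (1 + u) * (1 + u) * x + (1 + u) * x * (1 + u) + x * (1 + u) * (1 + u) = 0 := by
  have e1 : ((1 + x) * u) ^ 3 - (1 + (1 + x) * u + ((1 + x) * u) ^ 2) =
      (u ^ 3 - (1 + u + u ^ 2)) + (x * u * u + u * x * u + u * u * x - x - x * u - u * x) * u
      + (x * u * x) * u * u + (x * u ^ 2 * x) * u + u * (x * u * x) * u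
      + (x * u * x) * u * x * u - (x * u * x) * u := by noncomm_ring
  rw [hU, hu, h1, h3] at e1
  simp only [sub_self, zero_mul, mul_zero, add_zero, zero_add, sub_zero] at e1
  have e2 : x * u * u + u * x * u + u * u * x - x - x * u - u * x = 0 := by
    rw [← mul_one (_ - u * x), ← hud, ← mul_assoc, ← e1, zero_mul]
  have e3 : (1 + u) * (1 + u) * x + (1 + u) * x * (1 + u) + x * (1 + u) * (1 + u) =
      (x * u * u + u * x * u + u * u * x - x - x * u - u * x)
        + 2 * (2 * x + 2 * (u * x) + 2 * (x * u)) := by noncomm_ring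
  rw [e3, e2, h2]
  simp

theorem not_injective_of_fullyRealizable_of_card_eq_four.{a, b, d}
    {A : Type a} [CommGroup A] [Finite A] (hA : ∀ a : A, a ^ 2 = 1)
    {C : Type b} [Group C] [IsCyclic C] (hC : Nat.card C = 4)
    {φ : C →* MulAut A} (h : FullyRealizable.{max a b, d} (A ⋊[φ] C)) :
    ¬ Function.Injective φ := by
  intro hφ
  obtain ⟨R, _, ι, h⟩ := exists_fullUnitEmbedding_of_fullyRealizable h
  have : Finite C := Nat.finite_of_card_ne_zero (by omega)
  obtain ⟨c, hc⟩ := IsCyclic.exists_generator (α := C)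
  have hord : orderOf c = 4 := by rw [orderOf_eq_card_of_forall_mem_zpowers hc, hC]
  have hc4 : c ^ 4 = 1 := by rw [← hord, pow_orderOf_eq_one]
  have haa : ∀ b : A, b * b = 1 := fun b => by rw [← sq, hA]
  have hcancel : ∀ b b' : A, b * (b * b') = b' := fun b b' => by rw [← mul_assoc, haa, one_mul]
  -- Multiplicative notation for `1 + φ c` over `𝔽₂`; hence `t ^ 4 = 1 + φ c ^ 4` is trivial.
  set t : A →* A := (φ c).toMonoidHom * MonoidHom.id A with ht
  have ht_apply : ∀ b, t b = φ c b * b := fun b => rfl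
  have hφ4 : ∀ b, φ c (φ c (φ c (φ c b))) = b := fun b => by
    simp only [← MulAut.mul_apply, ← map_mul]
    rw [show c * (c * (c * c)) = c ^ 4 by simp only [pow_succ, pow_zero, one_mul, mul_assoc], hc4,
      map_one]
    rfl
  have htt : ∀ b, t (t b) = φ c (φ c b) * b := fun b => by
    simp only [ht_apply, map_mul, mul_assoc, hcancel]
  have ht4 : ∀ b, t (t (t (t b))) = 1 := fun b => by
    simp only [htt, map_mul, mul_assoc, hcancel, hφ4, haa]
  have htc : ∀ b, φ c (t b) = t (t b) * t b := fun b => by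
    rw [ht_apply (t b), mul_assoc, haa, mul_one]
  have htφ : ∀ b, t (φ c b) = φ c (t b) := fun b => by simp only [ht_apply, map_mul]
  have hφt : ∀ b, φ c b = t b * b := fun b => by rw [ht_apply, mul_assoc, haa, mul_one]
  obtain ⟨b₁, hb₁⟩ : ∃ b, t (t b) ≠ 1 := by
    by_contra! hall
    have : φ (c ^ 2) = 1 := by
      ext b
      have h1 := hall b
      rw [htt] at h1
      rw [sq, map_mul, MulAut.mul_apply, MulAut.one_apply]
      exact (mul_left_inj b).1 (h1.trans (haa b).symm)
    have h1 : c ^ 2 = 1 := hφ (this.trans (map_one φ).symm)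
    have := orderOf_dvd_of_pow_eq_one h1
    rw [hord] at this
    norm_num at this
  obtain ⟨a, ha3, ha2⟩ : ∃ a, t (t (t a)) = 1 ∧ t (t a) ≠ 1 := by
    by_cases h3 : t (t (t b₁)) = 1
    · exact ⟨b₁, h3, hb₁⟩
    · exact ⟨t b₁, ht4 b₁, h3⟩
  -- Otherwise the image of `t` lies in that of `t²`; iterating puts `t² b₁` in the image of `t⁴`,
  -- which is trivial.
  obtain ⟨a₀, ha₀⟩ : ∃ a₀, t a₀ ∉ (t.comp t).range := by
    by_contra! hall
    obtain ⟨b₂, hb₂⟩ := hall b₁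
    obtain ⟨b₃, hb₃⟩ := hall b₂
    obtain ⟨b₄, hb₄⟩ := hall b₃
    simp only [MonoidHom.comp_apply] at hb₂ hb₃ hb₄
    apply hb₁
    rw [← hb₂, ← hb₃, ← hb₄, ht4]
  obtain ⟨χ, hχ1, hχ0⟩ := exists_hom_zmod_two hA _ ha₀
  replace hχ0 : ∀ b, χ (t (t b)) = 1 := fun b => hχ0 _ ⟨b, rfl⟩
  -- Passing from `a₀` to `φ c a₀` flips `χ a₀` and keeps `χ (t a₀)`.
  obtain ⟨a₀, hχ1, hχa₀⟩ : ∃ a₀, χ (t a₀) = Multiplicative.ofAdd 1 ∧ χ a₀ = 1 := by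
    rcases eq_one_or_of_multiplicative_zmod_two (χ a₀) with h4 | h4
    · exact ⟨a₀, hχ1, h4⟩
    · refine ⟨φ c a₀, ?_, ?_⟩
      · rw [htφ, htc, map_mul, hχ0, one_mul, hχ1]
      · rw [hφt, map_mul, hχ1, h4]
        rfl
  have h2 := h.two_eq_zero
  have hself := h.add_self
  set u := ι (inr c) with hu_def
  set d := ι (inr c⁻¹) with hd_def
  have hud : u * d = 1 := by
    rw [hu_def, hd_def, ← map_mul, ← map_mul, mul_inv_cancel, map_one, map_one]
  have hdu : d * u = 1 := by
    rw [hu_def, hd_def, ← map_mul, ← map_mul, inv_mul_cancel, map_one, map_one]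
  have hu3 : u ^ 3 = 1 + u + u ^ 2 := h.pow_three_eq_of_orderOf_eq_four hc hord
  have hy3 : (1 + u) * (1 + u) * (1 + u) = 0 := by
    have : (1 + u) * (1 + u) * (1 + u) = u ^ 3 - (1 + u + u ^ 2) + 2 * (1 + 2 * u + 2 * u ^ 2) := by
      noncomm_ring
    rw [this, hu3, h2]
    simp
  have hleft0 : ∀ w : R, (1 + u) * w = w → w = 0 := fun w hw =>
    mul_eq_zero_of_pow_three_eq_zero hy3 hw
  have hright0 : ∀ w : R, w * (1 + u) = w → w = 0 := fun w hw => by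
    rw [← hw, ← hw, ← hw, mul_assoc, mul_assoc, ← mul_assoc (1 + u), hy3, mul_zero]
  have hinj : ∀ w : R, u * u * u * w * d * d * d = 0 → w = 0 := fun w hw => by
    have h4 : ∀ v : R, v * d = 0 → v = 0 := fun v hv => by
      rw [← mul_one v, ← hdu, ← mul_assoc, hv, zero_mul]
    have h5 : ∀ v : R, u * v = 0 → v = 0 := fun v hv => by
      rw [← one_mul v, ← hdu, mul_assoc, hv, mul_zero]
    refine h5 _ (h5 _ (h5 _ (h4 _ (h4 _ (h4 _ ?_)))))
    simpa only [mul_assoc] using hw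
  have hdcomm : d * (1 + u) = (1 + u) * d := by rw [mul_add, add_mul, hdu, hud, mul_one, one_mul]
  -- Left multiplication by `1 + u` commutes with conjugation by `u`, so applying it three times
  -- gives the threefold conjugate of `w`, while `(1 + u)³ = 0`.
  have hleftconj : ∀ w : R, (1 + u) * w = u * w * d → w = 0 := fun w hw => by
    refine hinj w ?_
    have hstep : ∀ v : R, (1 + u) * (u * v * d) = u * ((1 + u) * v) * d := fun v => by
      noncomm_ring
    have h4 : (1 + u) * ((1 + u) * ((1 + u) * w)) = 0 := by
      rw [← mul_assoc, ← mul_assoc, hy3, zero_mul]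
    rw [hw, hstep, hw, hstep, hstep, hw] at h4
    simpa only [mul_assoc] using h4
  have hrightconj : ∀ w : R, w * (1 + u) = u * w * d → w = 0 := fun w hw => by
    refine hinj w ?_
    have hstep : ∀ v : R, u * v * d * (1 + u) = u * (v * (1 + u)) * d := fun v => by
      rw [mul_assoc _ d, hdcomm]
      simp only [mul_assoc]
    have h4 : w * (1 + u) * (1 + u) * (1 + u) = 0 := by
      rw [mul_assoc, mul_assoc, ← mul_assoc (1 + u), hy3, mul_zero]
    rw [hw, hstep, hw, hstep, hstep, hw] at h4
    simpa only [mul_assoc] using h4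
  -- multiplication by `1 + u` kills the elements commuting with `u`
  have hK : ∀ w ∈ augSet ι, u * w = w * u → (1 + u) * w = 0 ∧ w * (1 + u) = 0 := by
    intro w hw hcomm
    obtain ⟨e, rfl⟩ := h.exists_eq_one_add_of_mem_augSet hw
    have he : φ c e = e := by
      have h1 : u * ι (inl e) = ι (inl e) * u := by
        rw [mul_add, add_mul, mul_one, one_mul] at hcomm
        exact add_left_cancel hcomm
      rw [hu_def, ← map_mul, ← map_mul] at h1
      have h3 := congrArg SemidirectProduct.left (h.injective h1)
      simpa using h3
    have hpow : ∀ z, φ c (involutionHom e (hA e) z) = involutionHom e (hA e) z := fun z =>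
      (map_pow (φ c) _ _).trans (by rw [he]; rfl)
    -- The map `b ↦ e ^ χ (t b)` is equivariant, since `e` is fixed and `χ ∘ t²` is trivial. It
    -- sends `a₀` to `e` and has image `{1, e}`; the value `e` is excluded by nilpotence.
    obtain ⟨⟨b, hb⟩, ⟨b', hb'⟩⟩ := h.exists_one_add_mul_eq hA hc
      ((involutionHom e (hA e)).comp (χ.comp t)) (fun b => by
        simp only [MonoidHom.comp_apply, hpow, htφ, htc, map_mul χ, hχ0, one_mul]) a₀
    simp only [MonoidHom.comp_apply, hχ1, involutionHom_ofAdd_one] at hb hb'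
    constructor
    · rcases eq_one_or_of_multiplicative_zmod_two (χ (t b)) with h4 | h4
      · rw [hb, h4, map_one, map_one, map_one, hself]
      · rw [h4, involutionHom_ofAdd_one] at hb
        rw [hleft0 _ hb, mul_zero]
    · rcases eq_one_or_of_multiplicative_zmod_two (χ (t b')) with h4 | h4
      · rw [hb', h4, map_one, map_one, map_one, hself]
      · rw [h4, involutionHom_ofAdd_one] at hb'
        rw [hright0 _ hb', zero_mul]
  have hT := h.one_add_apply_mul_eq hA c
  -- multiplication by `1 + u` on the kernel of the square of `t`
  have hL : ∀ e, t (t e) = 1 →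
      ((1 + u) * (1 + ι (inl e)) = 0 ∨ (1 + u) * (1 + ι (inl e)) = 1 + ι (inl (t e))) ∧
      ((1 + ι (inl e)) * (1 + u) = 0 ∨ (1 + ι (inl e)) * (1 + u) = 1 + ι (inl (t e))) := by
    intro e he
    have hpow : ∀ z, φ c (involutionHom e (hA e) z) =
        involutionHom (t e) (hA _) z * involutionHom e (hA e) z := fun z =>
      (map_pow (φ c) _ _).trans (by rw [hφt, mul_pow]; rfl)
    have hpow' : ∀ z, φ c (involutionHom (t e) (hA _) z) = involutionHom (t e) (hA _) z := fun z =>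
      (map_pow (φ c) _ _).trans (by rw [htc, he, one_mul]; rfl)
    -- The map `b ↦ e ^ χ (t b) * t e ^ χ b` again sends `a₀` to `e`. Of the values 1, `e`, `t e`,
    -- `e * t e`, nilpotence excludes `e` and its conjugate `e * t e` unless `1 + ι (inl e) = 0`.
    obtain ⟨⟨b, hb⟩, ⟨b', hb'⟩⟩ := h.exists_one_add_mul_eq hA hc
      ((involutionHom e (hA e)).comp (χ.comp t) * (involutionHom (t e) (hA _)).comp χ) (fun b => by
        simp only [MonoidHom.mul_apply, MonoidHom.comp_apply, map_mul (φ c), hpow, hpow', htφ, htc]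
        rw [hφt b]
        simp only [map_mul, hχ0, one_mul]
        simp only [mul_comm, mul_left_comm]) a₀
    have hfa : ((involutionHom e (hA e)).comp (χ.comp t) * (involutionHom (t e) (hA _)).comp χ) a₀
        = e := by
      simp [hχ1, hχa₀, involutionHom_ofAdd_one]
    have hconj : 1 + ι (inl (e * t e)) = u * (1 + ι (inl e)) * d := by
      rw [mul_comm, ← hφt, inl_aut, map_mul, map_mul, mul_add, add_mul, mul_one, hud]
    rw [hfa] at hb hb'
    simp only [MonoidHom.mul_apply, MonoidHom.comp_apply] at hb hb'
    constructor
    · rcases eq_one_or_of_multiplicative_zmod_two (χ b) with h4 | h4 <;>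
      rcases eq_one_or_of_multiplicative_zmod_two (χ (t b)) with h5 | h5 <;>
      simp only [h4, h5, involutionHom_ofAdd_one, map_one, mul_one, one_mul, hself] at hb
      · exact Or.inl hb
      · exact Or.inl (by rw [hleft0 _ hb, mul_zero])
      · exact Or.inr hb
      · exact Or.inl (by rw [hleftconj _ (hb.trans hconj), mul_zero])
    · rcases eq_one_or_of_multiplicative_zmod_two (χ b') with h4 | h4 <;>
      rcases eq_one_or_of_multiplicative_zmod_two (χ (t b')) with h5 | h5 <;>
      simp only [h4, h5, involutionHom_ofAdd_one, map_one, mul_one, one_mul, hself] at hb'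
      · exact Or.inl hb'
      · exact Or.inl (by rw [hright0 _ hb', zero_mul])
      · exact Or.inr hb'
      · exact Or.inl (by rw [hrightconj _ (hb'.trans hconj), zero_mul])
  have hxJ := h.one_add_mem_augSet a
  have hU : ((1 + (1 + ι (inl a))) * u) ^ 3 =
      1 + (1 + (1 + ι (inl a))) * u + ((1 + (1 + ι (inl a))) * u) ^ 2 := by
    have hg : (inl a * inr c : A ⋊[φ] C) ^ orderOf c = 1 := by
      -- In characteristic 2 the norm `1 + φ c + φ c ^ 2 + φ c ^ 3` is `t ^ 3`, which kills `a`.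
      -- Hence `c ↦ a * c`, trivial on `A`, defines an endomorphism.
      have hnorm : a * φ c a * φ c (φ c a) * φ c (φ c (φ c a)) = 1 := by
        have h4 := ha3
        rw [htt, ht_apply] at h4
        simp only [map_mul] at h4
        rw [← h4]
        simp only [mul_comm, mul_left_comm]
      rw [hord]
      ext
      · simpa [pow_succ, mul_assoc] using hnorm
      · change rightHom ((inl a * inr c : A ⋊[φ] C) ^ 4) = 1
        rw [map_pow, map_mul, rightHom_inl, rightHom_inr, one_mul, hc4]
    obtain ⟨F, -, hFc⟩ := exists_endomorphism (φ := φ) hc (1 : A →* A ⋊[φ] C) (inl a * inr c) hg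
      (by simp)
    obtain ⟨S, hS⟩ := h.exists_lift F
    have hSu : S u = (1 + (1 + ι (inl a))) * u := by
      rw [hu_def, hS, hFc, map_mul, ← add_assoc, hself, zero_add]
    simpa only [map_pow, map_add, map_one, hSu] using congrArg S hu3
  have hrel := quadratic_relation_of_pow_three_eq h2 (x := 1 + ι (inl a)) hud hu3 hU
    (h.augSet_mul_apply_mul hA hxJ (inr c)) (by
      rw [hu_def, ← map_pow]
      exact h.augSet_mul_apply_mul hA hxJ _)
  have hzu : u * (1 + ι (inl (t (t a)))) = (1 + ι (inl (t (t a)))) * u := by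
    have h4 : φ c (t (t a)) = t (t a) := by rw [hφt, ha3, one_mul]
    rw [mul_add, add_mul, mul_one, one_mul, hu_def, ← map_mul, ← map_mul]
    congr 2
    ext <;> simp [h4]
  have hmem : ∀ w ∈ ({1 + ι (inl (t (t a))), (1 + u) * (1 + ι (inl a)),
      (1 + ι (inl a)) * (1 + u)} : Set R), w ∈ augSet ι := by
    rintro w (rfl | rfl | rfl)
    · exact h.one_add_mem_augSet _
    · rw [add_mul, one_mul]
      exact h.augSet_add_mem hA hxJ (h.mul_augSet_mem hA hxJ _)
    · rw [mul_add (1 + ι (inl a)), mul_one]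
      exact h.augSet_add_mem hA hxJ (h.augSet_mul_mem hA hxJ _)
  have hz := eq_zero_of_quadratic_relation h2 hdu (1 + ι (inl (t a))) (1 + ι (inl (t (t a))))
    (hT a) (hT (t a)) hzu hrel (fun w hw => hK w (hmem w hw)) (hL (t a) ha3).1 (hL (t a) ha3).2
  refine ha2 (inl_injective (φ := φ) ((h.eq_one_of_apply ?_).trans (map_one _).symm))
  rw [add_eq_zero_iff_eq_neg] at hz
  rw [← neg_eq_of_add_eq_zero_left (hself (ι _)), ← hz]

/-! ### From embeddings to realizability; elementary abelian groups -/

theorem FullUnitEmbedding.fullyRealizes {R G : Type*} [Ring R] [Group G] {ι : G →* R}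
    (h : FullUnitEmbedding ι) : FullyRealizes R G := by
  have hbij : Function.Bijective ι.toHomUnits := by
    refine ⟨fun a b hab => h.injective ?_, fun u => ?_⟩
    · simpa using congrArg Units.val hab
    · obtain ⟨g, hg⟩ := h.exists_of_isUnit u u.isUnit
      exact ⟨g, Units.ext hg⟩
  refine ⟨(MulEquiv.ofBijective ι.toHomUnits hbij).symm, fun f => ?_⟩
  obtain ⟨φ, hφ⟩ := h.exists_lift f
  refine ⟨φ, fun x => ?_⟩
  rw [MulEquiv.symm_apply_eq]
  obtain ⟨g, rfl⟩ := (MulEquiv.ofBijective ι.toHomUnits hbij).surjective x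
  rw [MulEquiv.symm_apply_apply]
  exact Units.ext (hφ g)

/-- A finite ring has a copy in every universe, so the universe of the realizing ring is free. -/
theorem FullUnitEmbedding.fullyRealizable.{a, b, d} {R : Type d} {G : Type a} [Ring R] [Finite R]
    [Group G] {ι : G →* R} (h : FullUnitEmbedding ι) : FullyRealizable.{a, b} G := by
  let _ : Ring (Shrink.{b} R) := (equivShrink.{b} R).symm.ring
  let e : R ≃+* Shrink.{b} R := (equivShrink.{b} R).symm.ringEquiv.symm
  refine ⟨Shrink.{b} R, inferInstance, FullUnitEmbedding.fullyRealizes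
    (ι := (e : R →* Shrink.{b} R).comp ι) ⟨?_, ?_, ?_⟩⟩
  · exact e.injective.comp h.injective
  · intro r hr
    obtain ⟨g, hg⟩ := h.exists_of_isUnit (e.symm r) (hr.map e.symm)
    exact ⟨g, by simp [hg]⟩
  · intro f
    obtain ⟨φ, hφ⟩ := h.exists_lift f
    exact ⟨(e : R →+* Shrink.{b} R).comp (φ.comp e.symm), fun g => by simp [hφ]⟩

theorem fullyRealizable_of_sq_eq_one.{a, b} {G : Type a} [CommGroup G] [Finite G]
    (hG : ∀ g : G, g ^ 2 = 1) : FullyRealizable.{a, b} G := by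
  let _ : Module (ZMod 2) (Additive G) := AddCommGroup.zmodModule fun x => hG x.toMul
  let _ : Module (ZMod 2)ᵐᵒᵖ (Additive G) := Module.compHom (Additive G)
    ((RingHom.id (ZMod 2)).fromOpposite fun _ _ => Commute.all _ _)
  have : IsCentralScalar (ZMod 2) (Additive G) := ⟨fun _ _ => rfl⟩
  let ι : G →* TrivSqZeroExt (ZMod 2) (Additive G) :=
    { toFun := fun g => (1, Additive.ofMul g)
      map_one' := rfl
      map_mul' := fun g k => TrivSqZeroExt.ext (one_mul 1).symm (by
        change Additive.ofMul (g * k) = (1 : ZMod 2) • Additive.ofMul k +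
          MulOpposite.op (1 : ZMod 2) • Additive.ofMul g
        rw [MulOpposite.op_one, one_smul, one_smul, mul_comm, ofMul_mul]) }
  have : Finite (TrivSqZeroExt (ZMod 2) (Additive G)) :=
    inferInstanceAs (Finite (ZMod 2 × Additive G))
  refine FullUnitEmbedding.fullyRealizable (ι := ι) ⟨fun g k hgk => ?_, fun r hr => ?_, fun f => ?_⟩
  · exact congrArg (fun v => Additive.toMul v) (congrArg TrivSqZeroExt.snd hgk)
  · have h1 : ∀ z : ZMod 2, z ≠ 0 → 1 = z := by decide
    exact ⟨r.snd.toMul, TrivSqZeroExt.ext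
      (h1 _ (TrivSqZeroExt.isUnit_iff_isUnit_fst.1 hr).ne_zero) rfl⟩
  · refine ⟨(TrivSqZeroExt.map ((MonoidHom.toAdditive f).toZModLinearMap 2) :
      TrivSqZeroExt (ZMod 2) (Additive G) →ₐ[ZMod 2] _), fun g => ?_⟩
    exact TrivSqZeroExt.ext (by
      change TrivSqZeroExt.fst (TrivSqZeroExt.map _ _) = _
      rw [TrivSqZeroExt.fst_map]
      rfl) (by
      change TrivSqZeroExt.snd (TrivSqZeroExt.map _ _) = _
      rw [TrivSqZeroExt.snd_map]
      rfl)

/-! ### Semidirect products in square-zero extensions -/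

namespace SemidirectProduct

variable {A C : Type*} [CommGroup A] [Group C] {φ : C →* MulAut A} {S : Type*} [CommRing S]
  [Module S (Additive A)] [Module Sᵐᵒᵖ (Additive A)]

/-- The semidirect product `A ⋊ C` inside the trivial square-zero extension of `S` by `A`, where
`C` is identified with the units of `S` and acts trivially from the right. -/
def toTrivSqZeroExt (j : C ≃* Sˣ)
    (hl : ∀ c a, (j c : S) • Additive.ofMul a = Additive.ofMul (φ c a))
    (hr : ∀ c (v : Additive A), MulOpposite.op (j c : S) • v = v) :
    A ⋊[φ] C →* TrivSqZeroExt S (Additive A) where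
  toFun g := (j g.right, Additive.ofMul g.left)
  map_one' := TrivSqZeroExt.ext (by simp) (by simp)
  map_mul' g k := by
    refine TrivSqZeroExt.ext ?_ ?_
    · change ((j (g * k).right : Sˣ) : S) = j g.right * j k.right
      simp
    · change Additive.ofMul (g * k).left = (j g.right : S) • Additive.ofMul k.left +
        MulOpposite.op (j k.right : S) • Additive.ofMul g.left
      rw [hl, hr, mul_left, mul_comm, ofMul_mul]

variable {j : C ≃* Sˣ} {hl : ∀ c a, (j c : S) • Additive.ofMul a = Additive.ofMul (φ c a)}
    {hr : ∀ c (v : Additive A), MulOpposite.op (j c : S) • v = v}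

theorem fst_toTrivSqZeroExt (g : A ⋊[φ] C) :
    (toTrivSqZeroExt j hl hr g).fst = j g.right := rfl

theorem snd_toTrivSqZeroExt (g : A ⋊[φ] C) :
    (toTrivSqZeroExt j hl hr g).snd = Additive.ofMul g.left := rfl

theorem toTrivSqZeroExt_sub_one_mul_eq_zero {g k : A ⋊[φ] C} (hg : φ g.right = 1)
    (hgk : ((j g.right : S) - 1) * (j k.right - 1) = 0) :
    (toTrivSqZeroExt j hl hr g - 1) * (toTrivSqZeroExt j hl hr k - 1) = 0 := by
  refine TrivSqZeroExt.ext ?_ ?_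
  · simpa [fst_toTrivSqZeroExt] using hgk
  · simp [fst_toTrivSqZeroExt, snd_toTrivSqZeroExt, sub_smul, hl, hr, hg]

/-- The lift of `f` is `σ` on `S` and `v ↦ ι (f v) - 1` on `A`. The vanishing products in `hf` give
additivity, right linearity and square zero; linearity need only be checked on units, which span
`S`. -/
theorem fullUnitEmbedding_toTrivSqZeroExt [SMulCommClass S Sᵐᵒᵖ (Additive A)]
    (hgen : ∀ s : S, s ∈ AddSubgroup.closure (Set.range fun c => (j c : S)))
    (hσ : ∀ f : A ⋊[φ] C →* A ⋊[φ] C, ∃ σ : S →+* TrivSqZeroExt S (Additive A),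
      ∀ c, σ (j c) = toTrivSqZeroExt j hl hr (f (inr c)))
    (hf : ∀ (f : A ⋊[φ] C →* A ⋊[φ] C) (a : A) (g : A ⋊[φ] C),
      (toTrivSqZeroExt j hl hr (f (inl a)) - 1) * (toTrivSqZeroExt j hl hr (f g) - 1) = 0) :
    FullUnitEmbedding (toTrivSqZeroExt j hl hr) := by
  set ι := toTrivSqZeroExt j hl hr with hι
  refine ⟨fun g k hgk => ?_, fun r hr' => ?_, fun f => ?_⟩
  · have h1 : j g.right = j k.right := Units.ext (congrArg TrivSqZeroExt.fst hgk)
    have h2 : g.left = k.left := congrArg (fun v => Additive.toMul v) (congrArg TrivSqZeroExt.snd hgk)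
    exact SemidirectProduct.ext h2 (j.injective h1)
  · obtain ⟨u, hu⟩ := TrivSqZeroExt.isUnit_iff_isUnit_fst.1 hr'
    exact ⟨⟨r.snd.toMul, j.symm u⟩, TrivSqZeroExt.ext
      (by rw [hι, fst_toTrivSqZeroExt, j.apply_symm_apply, hu]) rfl⟩
  · obtain ⟨σ, hσ⟩ := hσ f
    have hmul : ∀ a g, ι (f (inl a)) * ι (f g) - ι (f g) = ι (f (inl a)) - 1 := fun a g => by
      have := hf f a g
      have h1 : ι (f (inl a)) * ι (f g) - ι (f g) - (ι (f (inl a)) - 1) =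
        (ι (f (inl a)) - 1) * (ι (f g) - 1) := by noncomm_ring
      rw [this] at h1
      exact sub_eq_zero.1 h1
    let γ : Additive A →+ TrivSqZeroExt S (Additive A) := AddMonoidHom.mk'
      (fun v => ι (f (inl v.toMul)) - 1) (fun v w => by
        have := hmul v.toMul (inl w.toMul)
        rw [toMul_add, map_mul, map_mul, map_mul, ← this]
        abel)
    have hγ : ∀ v, γ v = ι (f (inl v.toMul)) - 1 := fun v => rfl
    have hleft : ∀ (s : S) v, γ (s • v) = σ s * γ v := by
      intro s v
      induction hgen s using AddSubgroup.closure_induction with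
      | mem s hs =>
        obtain ⟨c, rfl⟩ := hs
        change γ ((j c : S) • Additive.ofMul v.toMul) = σ (j c) * γ v
        rw [hl, hσ, hγ, hγ, toMul_ofMul, inl_aut]
        simp only [map_mul, mul_assoc]
        have h2 := hmul v.toMul (inr c⁻¹)
        have h3 : ι (f (inr c)) * ι (f (inr c⁻¹)) = 1 := by
          rw [← map_mul, ← map_mul, ← map_mul, mul_inv_cancel, map_one, map_one, map_one]
        rw [← h2, mul_sub, h3]
      | zero => simp
      | add s s' _ _ h1 h2 => rw [add_smul, map_add, h1, h2, map_add, add_mul]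
      | neg s _ h1 => rw [neg_smul, map_neg, h1, map_neg, neg_mul]
    have hright : ∀ (s : S) v, γ (MulOpposite.op s • v) = γ v * σ s := by
      intro s v
      induction hgen s using AddSubgroup.closure_induction with
      | mem s hs =>
        obtain ⟨c, rfl⟩ := hs
        change γ (MulOpposite.op (j c : S) • v) = γ v * σ (j c)
        rw [hr, hσ, hγ, sub_mul, one_mul, hmul]
      | zero => simp
      | add s s' _ _ h1 h2 => rw [MulOpposite.op_add, add_smul, map_add, h1, h2, map_add, mul_add]
      | neg s _ h1 => rw [MulOpposite.op_neg, neg_smul, map_neg, h1, map_neg, mul_neg]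
    refine ⟨(TrivSqZeroExt.lift (S := ℤ) σ.toIntAlgHom γ.toIntLinearMap
      (fun v w => hf f v.toMul (inl w.toMul)) hleft hright :
        TrivSqZeroExt S (Additive A) →ₐ[ℤ] TrivSqZeroExt S (Additive A)), fun g => ?_⟩
    have h1 : (TrivSqZeroExt.lift (S := ℤ) σ.toIntAlgHom γ.toIntLinearMap
      (fun v w => hf f v.toMul (inl w.toMul)) hleft hright) (ι g) =
        σ (j g.right) + γ (Additive.ofMul g.left) := rfl
    refine h1.trans ?_
    rw [hσ, hγ, toMul_ofMul, ← hmul g.left (inr g.right), ← map_mul, ← map_mul,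
      inl_left_mul_inr_right]
    abel

end SemidirectProduct

/-! ### Commutative rings with unit group cyclic of order three or four -/

/-- The ring `𝔽₂[g] / (g³ = 1 + κ (g + g²))`, with elements `coeff₀ + coeff₁ g + coeff₂ g²`. -/
@[ext]
structure CubicRing (κ : ZMod 2) where
  coeff₀ : ZMod 2
  coeff₁ : ZMod 2
  coeff₂ : ZMod 2

namespace CubicRing

variable {κ : ZMod 2}

instance : Zero (CubicRing κ) := ⟨⟨0, 0, 0⟩⟩
instance : One (CubicRing κ) := ⟨⟨1, 0, 0⟩⟩
instance : Add (CubicRing κ) :=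
  ⟨fun s t => ⟨s.coeff₀ + t.coeff₀, s.coeff₁ + t.coeff₁, s.coeff₂ + t.coeff₂⟩⟩
instance : Neg (CubicRing κ) := ⟨fun s => ⟨-s.coeff₀, -s.coeff₁, -s.coeff₂⟩⟩
instance : Mul (CubicRing κ) :=
  ⟨fun s t =>
    ⟨s.coeff₀ * t.coeff₀ + (s.coeff₁ * t.coeff₂ + s.coeff₂ * t.coeff₁)
        + κ * (s.coeff₂ * t.coeff₂),
      s.coeff₀ * t.coeff₁ + s.coeff₁ * t.coeff₀ + κ * (s.coeff₁ * t.coeff₂ + s.coeff₂ * t.coeff₁)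
        + (1 + κ ^ 2) * (s.coeff₂ * t.coeff₂),
      s.coeff₀ * t.coeff₂ + s.coeff₁ * t.coeff₁ + s.coeff₂ * t.coeff₀
        + κ * (s.coeff₁ * t.coeff₂ + s.coeff₂ * t.coeff₁)
        + (κ + κ ^ 2) * (s.coeff₂ * t.coeff₂)⟩⟩

theorem zero_def : (0 : CubicRing κ) = ⟨0, 0, 0⟩ := rfl
theorem one_def : (1 : CubicRing κ) = ⟨1, 0, 0⟩ := rfl
theorem add_def (s t : CubicRing κ) :
    s + t = ⟨s.coeff₀ + t.coeff₀, s.coeff₁ + t.coeff₁, s.coeff₂ + t.coeff₂⟩ := rfl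
theorem neg_def (s : CubicRing κ) : -s = ⟨-s.coeff₀, -s.coeff₁, -s.coeff₂⟩ := rfl
theorem mul_def (s t : CubicRing κ) : s * t =
    ⟨s.coeff₀ * t.coeff₀ + (s.coeff₁ * t.coeff₂ + s.coeff₂ * t.coeff₁)
        + κ * (s.coeff₂ * t.coeff₂),
      s.coeff₀ * t.coeff₁ + s.coeff₁ * t.coeff₀ + κ * (s.coeff₁ * t.coeff₂ + s.coeff₂ * t.coeff₁)
        + (1 + κ ^ 2) * (s.coeff₂ * t.coeff₂),
      s.coeff₀ * t.coeff₂ + s.coeff₁ * t.coeff₁ + s.coeff₂ * t.coeff₀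
        + κ * (s.coeff₁ * t.coeff₂ + s.coeff₂ * t.coeff₁)
        + (κ + κ ^ 2) * (s.coeff₂ * t.coeff₂)⟩ := rfl

instance : CommRing (CubicRing κ) where
  add_assoc r s t := by ext <;> simp only [add_def] <;> ring
  zero_add s := by ext <;> simp only [add_def, zero_def] <;> ring
  add_zero s := by ext <;> simp only [add_def, zero_def] <;> ring
  add_comm s t := by ext <;> simp only [add_def] <;> ring
  neg_add_cancel s := by ext <;> simp only [add_def, zero_def, neg_def] <;> ring
  mul_assoc r s t := by ext <;> simp only [mul_def] <;> ring
  one_mul s := by ext <;> simp only [mul_def, one_def] <;> ring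
  mul_one s := by ext <;> simp only [mul_def, one_def] <;> ring
  left_distrib r s t := by ext <;> simp only [mul_def, add_def] <;> ring
  right_distrib r s t := by ext <;> simp only [mul_def, add_def] <;> ring
  zero_mul s := by ext <;> simp only [mul_def, zero_def] <;> ring
  mul_zero s := by ext <;> simp only [mul_def, zero_def] <;> ring
  mul_comm s t := by ext <;> simp only [mul_def] <;> ring
  nsmul := nsmulRec
  zsmul := zsmulRec

/-- The coefficient triple as an equivalence. -/
def equivProd : CubicRing κ ≃ ZMod 2 × ZMod 2 × ZMod 2 where
  toFun s := (s.coeff₀, s.coeff₁, s.coeff₂)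
  invFun p := ⟨p.1, p.2.1, p.2.2⟩

instance : DecidableEq (CubicRing κ) := equivProd.injective.decidableEq
instance : Fintype (CubicRing κ) := Fintype.ofEquiv _ equivProd.symm

/-- The generator. -/
def gen : CubicRing κ := ⟨0, 1, 0⟩

open Polynomial in
/-- The polynomial representing an element. -/
noncomputable def toPoly (s : CubicRing κ) : (ZMod 2)[X] :=
  C s.coeff₀ + C s.coeff₁ * X + C s.coeff₂ * X ^ 2

open Polynomial in
-- The coefficient of the cubic is the quotient in the division of a quartic by it.
theorem toPoly_mul (s t : CubicRing κ) : toPoly s * toPoly t = toPoly (s * t) +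
    (C (s.coeff₁ * t.coeff₂ + s.coeff₂ * t.coeff₁) + C (s.coeff₂ * t.coeff₂) * (X + C κ)) *
      (X ^ 3 - (1 + C κ * (X + X ^ 2))) := by
  simp only [toPoly, mul_def, map_add, map_mul, map_pow, map_one]
  ring

open Polynomial in
/-- The ring homomorphism sending the generator to a root of the defining cubic. -/
noncomputable def lift {R : Type*} [Ring R] (k : ZMod 2 →+* R) (y : R)
    (hy : y ^ 3 = 1 + k κ * (y + y ^ 2)) : CubicRing κ →+* R :=
  have hcomm : ∀ z, Commute (k z) y := fun z => by
    have : z = 0 ∨ z = 1 := by revert z; decide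
    rcases this with rfl | rfl
    · rw [map_zero]; exact Commute.zero_left y
    · rw [map_one]; exact Commute.one_left y
  let ev : (ZMod 2)[X] →+* R := eval₂RingHom' k y hcomm
  have hev : ev (X ^ 3 - (1 + C κ * (X + X ^ 2))) = 0 := by
    have hX : ev X = y := eval₂_X k y
    have hC : ev (C κ) = k κ := eval₂_C k y
    simp only [map_sub, map_add, map_mul, map_pow, map_one, hX, hC, hy, sub_self]
  { toFun := fun s => ev (toPoly s)
    map_one' := by simp [toPoly, one_def]
    map_zero' := by simp [toPoly, zero_def]
    map_add' := fun s t => by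
      rw [← map_add]
      congr 1
      simp only [toPoly, add_def, map_add]
      ring
    map_mul' := fun s t => by
      rw [← map_mul, toPoly_mul, map_add, map_mul ev _ (X ^ 3 - _), hev, mul_zero, add_zero] }

open Polynomial in
theorem lift_gen {R : Type*} [Ring R] (k : ZMod 2 →+* R) (y : R)
    (hy : y ^ 3 = 1 + k κ * (y + y ^ 2)) : lift k y hy gen = y := by
  change eval₂ k y (toPoly gen) = y
  simp [toPoly, gen]

/-- The inclusion of the coefficients. -/
def coeffHom : ZMod 2 →+* CubicRing κ where
  toFun z := ⟨z, 0, 0⟩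
  map_one' := rfl
  map_zero' := rfl
  map_add' s t := by ext <;> simp [add_def]
  map_mul' s t := by ext <;> simp [mul_def]

/-- The exponent 12 serves both values of `κ`, where the orders are 3 and 4. -/
theorem gen_pow_twelve : (gen : CubicRing κ) ^ 12 = 1 := by
  revert κ
  decide +kernel

/-- The generator as a unit. -/
def genUnit : (CubicRing κ)ˣ := Units.ofPowEqOne gen 12 gen_pow_twelve (by norm_num)

theorem exists_pow_of_isUnit {s : CubicRing κ} (hs : IsUnit s) : ∃ i : ℕ, i < 4 ∧ gen ^ i = s := by
  obtain ⟨t, ht⟩ := hs.exists_right_inv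
  revert κ
  decide +kernel

theorem mem_zpowers_genUnit (u : (CubicRing κ)ˣ) :
    u ∈ Subgroup.zpowers (genUnit : (CubicRing κ)ˣ) := by
  obtain ⟨i, -, hi⟩ := exists_pow_of_isUnit u.isUnit
  exact ⟨i, Units.ext (by simpa [genUnit] using hi)⟩

theorem mem_closure_of_pow_mem {P : Set (CubicRing κ)} (hP : ∀ i : ℕ, gen ^ i ∈ P)
    (s : CubicRing κ) : s ∈ AddSubgroup.closure P := by
  have key : ∀ s : CubicRing κ, ∃ i j k : Fin 2, s = (i : ℕ) • gen ^ 0 + (j : ℕ) • gen ^ 1 +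
      (k : ℕ) • gen ^ 2 := by
    clear! P
    clear s
    revert κ
    decide +kernel
  obtain ⟨i, j, k, rfl⟩ := key s
  exact add_mem (add_mem (nsmul_mem (AddSubgroup.subset_closure (hP 0)) _)
    (nsmul_mem (AddSubgroup.subset_closure (hP 1)) _))
    (nsmul_mem (AddSubgroup.subset_closure (hP 2)) _)

theorem orderOf_genUnit_zero : orderOf (genUnit : (CubicRing 0)ˣ) = 3 :=
  orderOf_eq_prime (Units.ext (by decide +kernel)) fun h =>
    absurd (congrArg Units.val h) (by decide +kernel)

theorem orderOf_genUnit_one : orderOf (genUnit : (CubicRing 1)ˣ) = 4 :=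
  orderOf_eq_prime_pow (p := 2) (n := 1) (fun h =>
    absurd (congrArg Units.val h) (by decide +kernel)) (Units.ext (by decide +kernel))

end CubicRing

namespace CubicRing

/-- For `κ = 0` only `s = 1` occurs. For `κ = 1`, `s - 1` is 0 or `(1 + g)²`, while `1 + g` divides
`t - 1` and `(1 + g)³ = 0`. -/
theorem sub_one_mul_sub_one_of_isUnit {κ : ZMod 2} {s t : CubicRing κ} (hs : IsUnit s)
    (ht : IsUnit t) (hs2 : s ^ 2 = 1) : (s - 1) * (t - 1) = 0 := by
  obtain ⟨i, hi, rfl⟩ := exists_pow_of_isUnit hs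
  obtain ⟨j, hj, rfl⟩ := exists_pow_of_isUnit ht
  clear hs ht
  revert κ i j
  decide +kernel

theorem pow_three_of_isUnit {s : CubicRing 1} (hs : IsUnit s) : s ^ 3 = 1 + (s + s ^ 2) := by
  obtain ⟨i, hi, rfl⟩ := exists_pow_of_isUnit hs
  revert i
  decide +kernel

end CubicRing

/-! ### Realization for orders three and four, and the theorem -/

/-- A cyclic group identified with the units of `CubicRing κ`, whose elements of order two act
trivially on `A`, gives a fully realizable semidirect product. -/
theorem fullyRealizable_of_cubicRing.{a, b, d} (κ : ZMod 2)
    {A : Type a} [CommGroup A] [Finite A] (hA : ∀ a : A, a ^ 2 = 1)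
    {C : Type b} [Group C] {φ : C →* MulAut A} {c : C} (hc : ∀ x, x ∈ Subgroup.zpowers c)
    (hord : orderOf c = orderOf (CubicRing.genUnit : (CubicRing κ)ˣ))
    (hinv : ∀ k : C, k ^ 2 = 1 → φ k = 1) :
    FullyRealizable.{max a b, d} (A ⋊[φ] C) := by
  have hκ : κ = 0 ∨ κ = 1 := (by decide : ∀ z : ZMod 2, z = 0 ∨ z = 1) κ
  let j : C ≃* (CubicRing κ)ˣ := mulEquivOfOrderOfEq hc CubicRing.mem_zpowers_genUnit hord
  have hjc : (j c : CubicRing κ) = CubicRing.gen := by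
    have : j c = CubicRing.genUnit := mulEquivOfOrderOfEq_apply_gen _ _ _
    rw [this]
    rfl
  have hc3 : κ = 0 → c ^ 3 = 1 := by
    rintro rfl
    rw [CubicRing.orderOf_genUnit_zero] at hord
    rw [← hord, pow_orderOf_eq_one]
  have hc4 : κ = 1 → c ^ 4 = 1 := by
    rintro rfl
    rw [CubicRing.orderOf_genUnit_one] at hord
    rw [← hord, pow_orderOf_eq_one]
  have hsq : κ = 1 → ∀ k : C, φ (k ^ 2) = 1 := by
    intro h1 k
    obtain ⟨i, rfl⟩ := hc k
    refine hinv _ ?_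
    change ((c ^ i) ^ 2) ^ 2 = 1
    rw [← pow_mul, ← zpow_natCast, ← zpow_mul, mul_comm, zpow_mul, zpow_natCast]
    norm_num [hc4 h1]
  have hcpow : ∀ k : C, ∃ i : ℕ, k = c ^ i := fun k => by
    obtain ⟨i, -, hi⟩ := CubicRing.exists_pow_of_isUnit (j k).isUnit
    exact ⟨i, j.injective (Units.ext (by rw [← hi, map_pow, Units.val_pow_eq_pow_val, hjc]))⟩
  let _ : Module (ZMod 2) (Additive A) := AddCommGroup.zmodModule fun x => hA x.toMul
  have hself : ∀ v : Additive A, v + v = 0 := fun v => (two_nsmul v).symm.trans (hA v.toMul)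
  let τ : AddMonoid.End (Additive A) := MonoidHom.toAdditive (φ c).toMonoidHom
  -- For `κ = 0` this is `τ ^ 3 = 1`. For `κ = 1` squares act trivially, so `τ ^ 3 = τ = 1 + τ + τ ^
  -- 2`.
  have hτ : τ ^ 3 = 1 + Module.toAddMonoidEnd (ZMod 2) (Additive A) κ * (τ + τ ^ 2) := by
    have hτ' : ∀ n : ℕ, ∀ v, (τ ^ n) v = Additive.ofMul (φ (c ^ n) v.toMul) := by
      intro n
      induction n with
      | zero => intro v; simp
      | succ n ih =>
        intro v
        rw [pow_succ', AddMonoid.End.coe_mul, Function.comp_apply, ih, pow_succ', map_mul,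
          MulAut.mul_apply]
        rfl
    rcases hκ with h0 | h1
    · subst h0
      rw [map_zero, zero_mul, add_zero]
      ext v
      rw [hτ', hc3 rfl, map_one]
      rfl
    · subst h1
      rw [map_one, one_mul]
      ext v
      have h3 : (τ ^ 2) v = v := by
        rw [hτ', hsq rfl, MulAut.one_apply]
        rfl
      have h4 : (τ ^ 3) v = τ v := by
        rw [pow_succ', AddMonoid.End.coe_mul, Function.comp_apply, h3]
      change (τ ^ 3) v = v + (τ v + (τ ^ 2) v)
      rw [h4, h3, add_left_comm, hself, add_zero]
  let L : CubicRing κ →+* AddMonoid.End (Additive A) := CubicRing.lift _ τ hτ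
  have hLg : L CubicRing.gen = τ := CubicRing.lift_gen _ τ hτ
  -- The augmentation `g ↦ 1` defines the right action, under which every unit acts trivially.
  let ε : CubicRing κ →+* ZMod 2 := CubicRing.lift (RingHom.id _) 1 
    ((by decide : ∀ z : ZMod 2, (1 : ZMod 2) ^ 3 = 1 + z * (1 + 1 ^ 2)) κ)
  let _ : Module (CubicRing κ) (Additive A) := Module.compHom (Additive A) L
  let _ : Module (CubicRing κ)ᵐᵒᵖ (Additive A) := Module.compHom (Additive A)
    (ε.fromOpposite fun _ _ => Commute.all _ _)
  have : SMulCommClass (CubicRing κ) (CubicRing κ)ᵐᵒᵖ (Additive A) :=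
    ⟨fun s t v => ZMod.map_smul (L s) (ε t.unop) v⟩
  have hl : ∀ k a, (j k : CubicRing κ) • Additive.ofMul a = Additive.ofMul (φ k a) := by
    intro k a
    obtain ⟨i, rfl⟩ := hcpow k
    rw [map_pow, Units.val_pow_eq_pow_val, hjc]
    induction i with
    | zero => simp
    | succ i ih =>
      rw [pow_succ', mul_smul, ih, pow_succ', map_mul, MulAut.mul_apply]
      change L CubicRing.gen _ = _
      rw [hLg]
      rfl
  have hr : ∀ k (v : Additive A), MulOpposite.op (j k : CubicRing κ) • v = v := by
    intro k v
    change ε (j k) • v = v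
    have h1 : ∀ z : ZMod 2, z ≠ 0 → z = 1 := by decide
    rw [h1 _ ((j k).isUnit.map ε).ne_zero, one_smul]
  have : Finite (TrivSqZeroExt (CubicRing κ) (Additive A)) :=
    inferInstanceAs (Finite (CubicRing κ × Additive A))
  refine (fullUnitEmbedding_toTrivSqZeroExt (j := j) (hl := hl) (hr := hr) ?_ ?_ ?_).fullyRealizable
  · refine CubicRing.mem_closure_of_pow_mem fun i => ⟨c ^ i, ?_⟩
    change ((j (c ^ i) : (CubicRing κ)ˣ) : CubicRing κ) = _
    rw [map_pow, Units.val_pow_eq_pow_val, hjc]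
  · intro f
    set ι := toTrivSqZeroExt j hl hr with hι
    have hy : ι (f (inr c)) ^ 3 = 1 + ((TrivSqZeroExt.inlHom (CubicRing κ) (Additive A)).comp
        CubicRing.coeffHom) κ * (ι (f (inr c)) + ι (f (inr c)) ^ 2) := by
      rcases hκ with h0 | h1
      · subst h0
        rw [map_zero, zero_mul, add_zero, ← map_pow, ← map_pow, ← map_pow, hc3 rfl, map_one,
          map_one, map_one]
      · subst h1
        rw [map_one, one_mul]
        generalize f (inr c) = g
        refine TrivSqZeroExt.ext ?_ ?_
        · simp only [TrivSqZeroExt.fst_pow, TrivSqZeroExt.fst_add, TrivSqZeroExt.fst_one]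
          exact CubicRing.pow_three_of_isUnit (j g.right).isUnit
        · have h3 : φ g.right (φ g.right g.left) = g.left := by
            rw [← MulAut.mul_apply, ← map_mul, ← sq, hsq rfl, MulAut.one_apply]
          have h4 : ∀ a : A, a * a = 1 := fun a => by rw [← sq, hA]
          rw [← map_pow, ← map_pow]
          change Additive.ofMul (g ^ 3).left =
            0 + (Additive.ofMul g.left + Additive.ofMul (g ^ 2).left)
          rw [zero_add, ← ofMul_mul]
          congr 1
          simp only [pow_succ, pow_zero, one_mul, mul_left, mul_right, map_mul, MulAut.mul_apply, h3]
          rw [mul_right_comm, h4, one_mul, ← mul_assoc, h4, one_mul]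
    refine ⟨CubicRing.lift _ _ hy, fun k => ?_⟩
    obtain ⟨i, rfl⟩ := hcpow k
    rw [map_pow j, Units.val_pow_eq_pow_val, map_pow, hjc, CubicRing.lift_gen, ← map_pow,
      ← map_pow, ← map_pow]
  · intro f a g
    -- The image of `a` has square 1, so its `C`-component acts trivially by `hinv`; this makes the
    -- `A`-part of the product vanish too.
    have hk : (f (inl a)).right ^ 2 = 1 := by
      have : (f (inl a)) ^ 2 = 1 := by rw [← map_pow, ← map_pow, hA, map_one, map_one]
      have := congrArg rightHom this
      rwa [map_pow, map_one] at this
    refine toTrivSqZeroExt_sub_one_mul_eq_zero (hinv _ hk) ?_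
    refine CubicRing.sub_one_mul_sub_one_of_isUnit (j _).isUnit (j _).isUnit ?_
    rw [← Units.val_pow_eq_pow_val, ← map_pow, hk, map_one, Units.val_one]

theorem mainTheorem9 (p n : ℕ) (hp : p.Prime)
    (A : Type u) [CommGroup A] [Finite A] (hA : ∀ a : A, a ^ 2 = 1)
    (C : Type w) [Group C] [IsCyclic C] (hC : Nat.card C = p ^ n)
    (φ : C →* MulAut A) :
    (FullyRealizable.{max u w, v} (A ⋊[φ] C) →
      p ^ n = 1 ∨ p ^ n = 2 ∨ p ^ n = 3 ∨ p ^ n = 4) ∧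
    (p ^ n = 2 →
      (FullyRealizable.{max u w, v} (A ⋊[φ] C) ↔ ∀ g h : A ⋊[φ] C, g * h = h * g)) ∧
    (p ^ n = 4 →
      (FullyRealizable.{max u w, v} (A ⋊[φ] C) ↔ ¬ Function.Injective φ)) ∧
    ((p ^ n = 1 ∨ p ^ n = 3) → FullyRealizable.{max u w, v} (A ⋊[φ] C)) := by
  have : Finite C := Nat.finite_of_card_ne_zero (by rw [hC]; exact (pow_pos hp.pos n).ne')
  have : Finite (A ⋊[φ] C) := Finite.of_equiv _ SemidirectProduct.equivProd.symm
  obtain ⟨c, hc⟩ := IsCyclic.exists_generator (α := C)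
  have hord : orderOf c = p ^ n := by rw [orderOf_eq_card_of_forall_mem_zpowers hc, hC]
  have hpow : ∀ k : C, k ^ (p ^ n) = 1 := fun k => by rw [← hC, pow_card_eq_one']
  refine ⟨prime_pow_mem_of_fullyRealizable hp hC, fun h2 => ⟨?_, fun hcomm => ?_⟩,
    fun h4 => ⟨?_, fun hφ => ?_⟩, ?_⟩
  · exact commute_of_fullyRealizable_of_card_eq_two hA (hC.trans h2)
  · let _ : CommGroup (A ⋊[φ] C) := { (inferInstance : Group (A ⋊[φ] C)) with mul_comm := hcomm }
    refine fullyRealizable_of_sq_eq_one fun g => ?_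
    rw [← inl_left_mul_inr_right g, mul_pow, ← map_pow, ← map_pow, hA, ← h2, hpow, map_one,
      map_one, one_mul]
  · exact not_injective_of_fullyRealizable_of_card_eq_four hA (hC.trans h4)
  · rw [h4] at hord
    have hc4 : c ^ 4 = 1 := by rw [← hord, pow_orderOf_eq_one]
    have hcpow : ∀ k : C, ∃ i < 4, c ^ i = k := fun k => by
      classical
      have := mem_zpowers_iff_mem_range_orderOf.1 (hc k)
      simpa [hord] using this
    -- Every nontrivial subgroup of a cyclic group of order 4 contains `c ^ 2`.
    have hc2 : φ (c ^ 2) = 1 := by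
      rw [← MonoidHom.ker_eq_bot_iff, Subgroup.eq_bot_iff_forall] at hφ
      push Not at hφ
      obtain ⟨k, hk, hk1⟩ := hφ
      obtain ⟨i, hi, rfl⟩ := hcpow k
      rw [MonoidHom.mem_ker] at hk
      interval_cases i
      · exact absurd (pow_zero c) hk1
      · rw [map_pow, ← pow_one (φ c), ← map_pow, hk, one_pow]
      · exact hk
      · rw [← mul_one (c ^ 2), ← hc4, ← pow_add, show 2 + 4 = 3 * 2 by norm_num, pow_mul, map_pow, hk,
          one_pow]
    refine fullyRealizable_of_cubicRing 1 hA hc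
      (by rw [hord, CubicRing.orderOf_genUnit_one]) fun k hk => ?_
    obtain ⟨i, hi, rfl⟩ := hcpow k
    rw [← pow_mul] at hk
    have hdvd := orderOf_dvd_of_pow_eq_one hk
    rw [hord] at hdvd
    interval_cases i
    · rw [pow_zero, map_one]
    · norm_num at hdvd
    · exact hc2
    · norm_num at hdvd
  · rintro (h1 | h3)
    · have hk : ∀ k : C, k = 1 := fun k => by simpa [h1] using hpow k
      have hcomm : ∀ g k : A ⋊[φ] C, g * k = k * g := fun g k => by
        ext
        · simp [hk g.right, hk k.right, mul_comm]
        · simp [hk g.right, hk k.right]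
      let _ : CommGroup (A ⋊[φ] C) := { (inferInstance : Group (A ⋊[φ] C)) with mul_comm := hcomm }
      refine fullyRealizable_of_sq_eq_one fun g => ?_
      rw [← inl_left_mul_inr_right g, mul_pow, ← map_pow, ← map_pow, hA, hk (g.right ^ 2), map_one,
        map_one, one_mul]
    · refine fullyRealizable_of_cubicRing 0 hA hc
        (by rw [hord, h3, CubicRing.orderOf_genUnit_zero]) fun k hk => ?_
      have h5 := hpow k
      rw [h3, pow_succ, hk, one_mul] at h5
      rw [h5, map_one]
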